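/- For $\operatorname{Re} z>0$, $\nu\in\mathbb{C}$ let $K_\nu(z)=\int_0^\infty e^{-z\cosh u}\cosh(\nu u)\,du$ be the Macdonald function (modified Bessel function of the second kind), and for $x,w>0$ and $\nu\in\mathbb{C}$ with $\sin(\pi\nu/2)\neq 0$ let $$K_s(x,\nu,w)=\frac{1}{\sin(\pi\nu/2)}\int_0^w \sin(x\sinh u)\,\sinh(\nu u)\,du .$$ Write $\sinh^{-1}(u)=\log\bigl(u+\sqrt{1+u^2}\bigr)$, $\mathbb{N}=\{1,2,3,\dots\}$. Let $(a_m)_{m\in\mathbb{N}}$ be a sequence of complex numbers with $\sum_{m\ge1}|a_m|<\infty$. Then the series $\sum_{m\ge1}a_mK_{i\tau}(m)$ converges absolutely for every $\tau>0$, and for every $n\in\mathbb{N}$ $$a_n=\frac{4}{\pi^2 n}\lim_{\alpha\to\frac{\pi}{2}-}\int_0^\infty \tau\,\sinh\Bigl(\frac{\pi\tau}{2}\Bigr)\cosh(\alpha\tau)\,K_s\bigl(n,i\tau,\sinh^{-1}(\pi)\bigr)\sum_{m=1}^\infty a_mK_{i\tau}(m)\,d\tau ,$$ where the integral converges absolutely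 for every $\alpha\in(0,\pi/2)$. If moreover $\sum_{m\ge1}m|a_m|<\infty$, then the series $\sum_{m\ge1}a_mK_s\bigl(m,i\tau,\sinh^{-1}(\pi)\bigr)$ converges absolutely for every $\tau>0$, and for every $n\in\mathbb{N}$ $$a_n=\frac{2}{\pi^2 n}\lim_{N\to\infty}\int_0^N \tau\,\sinh(\pi\tau)\,K_{i\tau}(n)\sum_{m=1}^\infty a_mK_s\bigl(m,i\tau,\sinh^{-1}(\pi)\bigr)\,d\tau ,$$ where for every $N>0$ the integral over $(0,N)$ converges absolutely. -/

import Mathlib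

open MeasureTheory Filter Topology

noncomputable section

/-- The modified Bessel function of the second kind (Macdonald function)
`K_ν(z) = ∫_0^∞ exp(-z cosh u) cosh(ν u) du`, meaningful for `Re z > 0` and `ν ∈ ℂ`
(the integral converges absolutely there). -/
def macdonaldK (ν z : ℂ) : ℂ :=
  ∫ u in Set.Ioi (0 : ℝ), Complex.exp (-z * (Real.cosh u : ℂ)) * Complex.cosh (ν * (u : ℂ))

/-- The incomplete Bessel function
`K_s(x, ν, w) = (1 / sin(π ν / 2)) ∫_0^w sin(x sinh u) sinh(ν u) du`. -/
def incompleteKs (x : ℝ) (ν : ℂ) (w : ℝ) : ℂ :=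
  1 / Complex.sin ((Real.pi : ℂ) * ν / 2) *
    ∫ u in (0 : ℝ)..w, (Real.sin (x * Real.sinh u) : ℂ) * Complex.sinh (ν * (u : ℂ))

end

/-! With `K_{iτ}(x) = ∫_0^∞ exp(-x cosh u) cos(τu) du`, shifting the line of integration to height
`α`, `|α| < π/2`, exhibits `cosh(ατ) K_{iτ}(x)` as a cosine transform of `exp(-x cos α cosh v) cos(x
sin α sinh v)` (`integral_rotatedExp_mul_cos`). As `α → π/2` this function tends to `cos(x sinh v)`.
On the other side, one integration by parts turns `τ sinh(πτ/2) K_s(m, iτ, arsinh π)` into `m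
∫_0^{arsinh π} cosh u cos(m sinh u) cos(uτ) du`; the boundary term is `sin(mπ) = 0`, which explains
the upper limit. Pairing the two transforms and substituting `t = sinh u` leaves `(π/2) ∫_0^π
cos(mt) cos(nt) dt`, and orthogonality of cosines isolates `a_n`.

For the Abel-type limit, `α < π/2` makes everything absolutely convergent: `K_{iτ}(m)` decays like
`exp(-β|τ|)` for any `β < π/2`, uniformly in `m ≥ 1`. The sum may be integrated termwise, and each
term is an integral over a bounded range of `u`, continuous in `α` up to `π/2`; dominated
convergence in `m` finishes.

For the improper integral one works at `α = π/2`, where the function to be recovered, `cos(x sinh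
u)`, is not integrable. The truncated inverse transform is an integral against a Dirichlet kernel. A
second derivative test bounds its tails uniformly in the angle and in the cut-off `N`, so `α → π/2`
is possible at fixed `N` (`abs_truncated_sub_local_le_right_angle`). The remaining integral over
`[-R, R]` is handled by Riemann-Lebesgue and the Dirichlet integral. This gives pointwise
convergence (`tendsto_truncatedInverse`) with a uniform bound (`exists_bound_truncatedInverse`),
enough to pass to the limit against the continuous function `cosh u ∑ m a_m cos(m sinh u)`; its
continuity is where `∑ m|a_m| < ∞` enters. -/

/-- The real integral representation of `K_{iτ}(x)`. -/
noncomputable def klKernel (x τ : ℝ) : ℝ :=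
  ∫ u in Set.Ioi (0 : ℝ), Real.exp (-x * Real.cosh u) * Real.cos (τ * u)

/-- The real part of `exp (-x cosh (v + iα))`. -/
noncomputable def rotatedExp (x α v : ℝ) : ℝ :=
  Real.exp (-(x * Real.cos α) * Real.cosh v) * Real.cos (x * Real.sin α * Real.sinh v)

/-! ### Double-exponential decay of `exp (-c cosh v)`. -/

lemma quarter_sq_le_cosh (v : ℝ) : v ^ 2 / 4 ≤ Real.cosh v := by
  have h := Real.quadratic_le_exp_of_nonneg (abs_nonneg v)
  have h2 := Real.add_one_le_exp (-|v|)
  rw [← Real.cosh_abs, Real.cosh_eq]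
  have := sq_abs v
  nlinarith

lemma integrable_exp_neg_mul_cosh {c : ℝ} (hc : 0 < c) :
    Integrable fun v : ℝ => Real.exp (-c * Real.cosh v) := by
  refine (integrable_exp_neg_mul_sq (b := c / 4) (by positivity)).mono' (by fun_prop)
    (.of_forall fun v => ?_)
  rw [Real.norm_eq_abs, Real.abs_exp, Real.exp_le_exp]
  have := quarter_sq_le_cosh v
  nlinarith

/-- Half of the exponential absorbs the factor `y`, since `t exp(-t) ≤ 1`. This handles the factor
`cosh v` that differentiation of the integrand produces. -/
lemma mul_exp_neg_le {c : ℝ} (hc : 0 < c) (y : ℝ) :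
    y * Real.exp (-c * y) ≤ 2 / c * Real.exp (-(c / 2) * y) := by
  have h1 : Real.exp (-c * y) = Real.exp (-(c / 2) * y) * Real.exp (-(c / 2) * y) := by
    rw [← Real.exp_add]; ring_nf
  have h2 : (c / 2 * y) * Real.exp (-(c / 2) * y) ≤ 1 := by
    have := Real.add_one_le_exp (c / 2 * y)
    have h3 : Real.exp (c / 2 * y) * Real.exp (-(c / 2) * y) = 1 := by
      rw [← Real.exp_add]; ring_nf; simp
    nlinarith [Real.exp_pos (-(c / 2) * y)]
  have h4 : y * Real.exp (-(c / 2) * y) ≤ 2 / c := by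
    rw [le_div_iff₀ hc]; linarith
  calc y * Real.exp (-c * y) = (y * Real.exp (-(c / 2) * y)) * Real.exp (-(c / 2) * y) := by
        rw [h1]; ring
    _ ≤ _ := by gcongr

lemma integrable_cosh_mul_exp_neg_mul_cosh {c : ℝ} (hc : 0 < c) :
    Integrable fun v : ℝ => Real.cosh v * Real.exp (-c * Real.cosh v) := by
  refine ((integrable_exp_neg_mul_cosh (half_pos hc)).const_mul (2 / c)).mono' (by fun_prop)
    (.of_forall fun v => ?_)
  rw [Real.norm_eq_abs, abs_of_nonneg (by have := Real.cosh_pos v; positivity)]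
  exact mul_exp_neg_le hc _

lemma norm_complex_sinh_le (z : ℂ) : ‖Complex.sinh z‖ ≤ Real.cosh z.re := by
  rw [Complex.sinh, Real.cosh_eq, norm_div]
  have := norm_sub_le (Complex.exp z) (Complex.exp (-z))
  simp only [Complex.norm_exp, Complex.neg_re] at this
  norm_num
  linarith

/-! ### Shifting the line of integration. -/

lemma cosh_add_mul_I (v α : ℝ) : Complex.cosh (v + α * Complex.I)
    = (Real.cosh v * Real.cos α : ℝ) + (Real.sinh v * Real.sin α : ℝ) * Complex.I := by
  rw [Complex.cosh_add, Complex.cosh_mul_I, Complex.sinh_mul_I]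
  push_cast; ring

/-- The integrand of the Macdonald function, on the complex plane. -/
noncomputable def macdonaldIntegrand (x τ : ℝ) (z : ℂ) : ℂ :=
  Complex.exp (-x * Complex.cosh z + Complex.I * τ * z)

lemma norm_macdonaldIntegrand (x τ v α : ℝ) :
    ‖macdonaldIntegrand x τ (v + α * Complex.I)‖
      = Real.exp (-(x * Real.cos α) * Real.cosh v - τ * α) := by
  rw [macdonaldIntegrand, Complex.norm_exp, cosh_add_mul_I]
  congr 1
  simp [-Complex.ofReal_cos, -Complex.ofReal_sin, -Complex.ofReal_cosh, -Complex.ofReal_sinh]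
  ring

lemma hasDerivAt_macdonaldIntegrand (x τ : ℝ) (z : ℂ) :
    HasDerivAt (macdonaldIntegrand x τ)
      (macdonaldIntegrand x τ z * (-x * Complex.sinh z + Complex.I * τ)) z := by
  unfold macdonaldIntegrand
  have := ((Complex.hasDerivAt_cosh z).const_mul (-(x : ℂ))).add
    ((hasDerivAt_id z).const_mul (Complex.I * τ))
  simpa using this.cexp

lemma continuous_macdonaldIntegrand (x τ : ℝ) : Continuous (macdonaldIntegrand x τ) := by
  unfold macdonaldIntegrand; fun_prop

lemma cos_le_cos_of_abs_le {α β : ℝ} (hβ : β ≤ Real.pi) (h : |α| ≤ β) :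
    Real.cos β ≤ Real.cos α := by
  rw [← Real.cos_abs α]
  exact Real.cos_le_cos_of_nonneg_of_le_pi (abs_nonneg _) hβ h

lemma norm_macdonaldIntegrand_le {x τ α β : ℝ} (hx : 0 < x) (hβ : β < Real.pi / 2)
    (h : |α| ≤ β) (v : ℝ) :
    ‖macdonaldIntegrand x τ (v + α * Complex.I)‖
      ≤ Real.exp (|τ| * β) * Real.exp (-(x * Real.cos β) * Real.cosh v) := by
  rw [norm_macdonaldIntegrand, ← Real.exp_add, Real.exp_le_exp]
  have h1 : Real.cos β ≤ Real.cos α := cos_le_cos_of_abs_le (by linarith [Real.pi_pos]) h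
  have h2 : -(τ * α) ≤ |τ| * β := by
    calc -(τ * α) ≤ |τ * α| := neg_le_abs _
      _ = |τ| * |α| := abs_mul _ _
      _ ≤ _ := by gcongr
  have h3 := Real.cosh_pos v
  have h4 : x * Real.cos β * Real.cosh v ≤ x * Real.cos α * Real.cosh v := by gcongr
  linarith

lemma norm_deriv_macdonaldIntegrand_le {x τ α β : ℝ} (hx : 0 < x) (hβ : β < Real.pi / 2)
    (h : |α| ≤ β) (v : ℝ) :
    ‖macdonaldIntegrand x τ (v + α * Complex.I) *
        (-x * Complex.sinh (v + α * Complex.I) + Complex.I * τ)‖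
      ≤ Real.exp (|τ| * β) * (x * (Real.cosh v * Real.exp (-(x * Real.cos β) * Real.cosh v))
        + |τ| * Real.exp (-(x * Real.cos β) * Real.cosh v)) := by
  rw [norm_mul]
  have h1 : ‖-x * Complex.sinh (v + α * Complex.I) + Complex.I * τ‖ ≤ x * Real.cosh v + |τ| := by
    refine (norm_add_le _ _).trans ?_
    have := norm_complex_sinh_le (v + α * Complex.I)
    simp only [Complex.add_re, Complex.ofReal_re, Complex.mul_re, Complex.I_re, mul_zero,
      Complex.ofReal_im, Complex.I_im, mul_one, sub_self, add_zero] at this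
    simp only [norm_mul, norm_neg, Complex.norm_real, Real.norm_eq_abs, Complex.norm_I, one_mul,
      abs_of_pos hx]
    gcongr
  calc _ ≤ (Real.exp (|τ| * β) * Real.exp (-(x * Real.cos β) * Real.cosh v))
        * (x * Real.cosh v + |τ|) := by
        gcongr
        exact norm_macdonaldIntegrand_le hx hβ h v
    _ = _ := by ring

lemma cos_pos_of_abs_lt {α : ℝ} (h : |α| < Real.pi / 2) : 0 < Real.cos α :=
  Real.cos_pos_of_mem_Ioo ⟨by linarith [(abs_lt.1 h).1], (abs_lt.1 h).2⟩

lemma integrable_macdonaldIntegrand {x τ α : ℝ} (hx : 0 < x) (hα : |α| < Real.pi / 2) :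
    Integrable fun v : ℝ => macdonaldIntegrand x τ (v + α * Complex.I) := by
  have hc : 0 < Real.cos |α| := by rw [Real.cos_abs]; exact cos_pos_of_abs_lt hα
  refine ((integrable_exp_neg_mul_cosh (mul_pos hx hc)).const_mul (Real.exp (|τ| * |α|))).mono'
    ((continuous_macdonaldIntegrand x τ).comp (by fun_prop)).aestronglyMeasurable
    (.of_forall fun v => norm_macdonaldIntegrand_le hx hα le_rfl v)

lemma continuous_deriv_macdonaldIntegrand (x τ α : ℝ) :
    Continuous fun v : ℝ => macdonaldIntegrand x τ (v + α * Complex.I) *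
        (-x * Complex.sinh (v + α * Complex.I) + Complex.I * τ) := by
  refine ((continuous_macdonaldIntegrand x τ).comp (by fun_prop)).mul (by fun_prop)

lemma integrable_deriv_bound {x τ β : ℝ} (hc : 0 < x * Real.cos β) :
    Integrable fun v => Real.exp (|τ| * β) *
      (x * (Real.cosh v * Real.exp (-(x * Real.cos β) * Real.cosh v))
        + |τ| * Real.exp (-(x * Real.cos β) * Real.cosh v)) :=
  (((integrable_cosh_mul_exp_neg_mul_cosh hc).const_mul x).add
    ((integrable_exp_neg_mul_cosh hc).const_mul |τ|)).const_mul _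

lemma integral_deriv_macdonaldIntegrand {x τ α : ℝ} (hx : 0 < x) (hα : |α| < Real.pi / 2) :
    ∫ v : ℝ, macdonaldIntegrand x τ (v + α * Complex.I) *
        (-x * Complex.sinh (v + α * Complex.I) + Complex.I * τ) = 0 := by
  have hc : 0 < Real.cos |α| := by rw [Real.cos_abs]; exact cos_pos_of_abs_lt hα
  refine integral_eq_zero_of_hasDerivAt_of_integrable (f := fun v : ℝ =>
    macdonaldIntegrand x τ (v + α * Complex.I)) (fun v => ?_) ?_
    (integrable_macdonaldIntegrand hx hα)
  · exact ((hasDerivAt_macdonaldIntegrand x τ (v + α * Complex.I)).comp_add_const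
      (v : ℂ) (α * Complex.I)).comp_ofReal
  · exact (integrable_deriv_bound (τ := τ) (mul_pos hx hc)).mono'
      (continuous_deriv_macdonaldIntegrand x τ α).aestronglyMeasurable
      (.of_forall fun v => norm_deriv_macdonaldIntegrand_le hx hα le_rfl v)

/-- By holomorphy the derivative in `α` is `I` times the derivative along the line, and the latter
integrates to zero by decay at both ends. This replaces Cauchy's theorem on rectangles. -/
lemma hasDerivAt_integral_macdonaldIntegrand {x τ α : ℝ} (hx : 0 < x) (hα : |α| < Real.pi / 2) :
    HasDerivAt (fun α : ℝ => ∫ v : ℝ, macdonaldIntegrand x τ (v + α * Complex.I)) 0 α := by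
  -- An angle strictly between `|α|` and `π/2` supplies one dominating function for all heights near
  -- `α`.
  obtain ⟨β, hβ1, hβ2⟩ := exists_between hα
  have hβ0 : |β| < Real.pi / 2 := by rwa [abs_of_pos ((abs_nonneg α).trans_lt hβ1)]
  have hs : {α : ℝ | |α| < β} ∈ 𝓝 α := (isOpen_lt continuous_abs continuous_const).mem_nhds hβ1
  have key := (hasDerivAt_integral_of_dominated_loc_of_deriv_le
    (F := fun α v : ℝ => macdonaldIntegrand x τ (v + α * Complex.I))
    (F' := fun α v : ℝ => macdonaldIntegrand x τ (v + α * Complex.I) *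
        (-x * Complex.sinh (v + α * Complex.I) + Complex.I * τ) * Complex.I)
    (μ := volume) hs
    (.of_forall fun a => ((continuous_macdonaldIntegrand x τ).comp
      (by fun_prop)).aestronglyMeasurable)
    (integrable_macdonaldIntegrand hx hα)
    ((continuous_deriv_macdonaldIntegrand x τ α).mul continuous_const).aestronglyMeasurable
    (.of_forall fun v a ha => by
      rw [norm_mul, Complex.norm_I, mul_one]
      exact norm_deriv_macdonaldIntegrand_le hx hβ2 (le_of_lt ha) v)
    (integrable_deriv_bound (mul_pos hx (cos_pos_of_abs_lt hβ0)))
    (.of_forall fun v a _ => by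
      have h1 : HasDerivAt (fun z : ℂ => (v : ℂ) + z * Complex.I) Complex.I a := by
        simpa using ((hasDerivAt_id (a : ℂ)).mul_const Complex.I).const_add (v : ℂ)
      have h2 := HasDerivAt.comp (h₂ := macdonaldIntegrand x τ) (a : ℂ)
        (hasDerivAt_macdonaldIntegrand x τ (v + a * Complex.I)) h1
      exact h2.comp_ofReal)).2
  rwa [integral_mul_const, integral_deriv_macdonaldIntegrand hx hα, zero_mul] at key

lemma integral_macdonaldIntegrand_eq {x τ α : ℝ} (hx : 0 < x) (hα : |α| < Real.pi / 2) :
    ∫ v : ℝ, macdonaldIntegrand x τ (v + α * Complex.I)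
      = ∫ v : ℝ, macdonaldIntegrand x τ v := by
  have hconv : Convex ℝ (Set.Ioo (-(Real.pi / 2)) (Real.pi / 2)) := convex_Ioo _ _
  have := hconv.norm_image_sub_le_of_norm_hasDerivWithin_le (C := 0)
    (f := fun α : ℝ => ∫ v : ℝ, macdonaldIntegrand x τ (v + α * Complex.I)) (f' := fun _ => 0)
    (fun a ha => (hasDerivAt_integral_macdonaldIntegrand hx (abs_lt.2 ha)).hasDerivWithinAt)
    (by simp) (x := 0) (y := α) (Set.mem_Ioo.2 ⟨by linarith [Real.pi_pos], by linarith [Real.pi_pos]⟩)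
    (Set.mem_Ioo.2 (abs_lt.1 hα))
  simpa [sub_eq_zero] using this

/-! ### The rotated exponential and its cosine transform. -/

lemma integral_even {f : ℝ → ℝ} (hf : ∀ v, f (-v) = f v) :
    ∫ v, f v = 2 * ∫ v in Set.Ioi (0 : ℝ), f v := by
  rw [← integral_comp_abs]
  congr 1
  ext v
  rcases abs_choice v with h | h <;> rw [h]
  rw [hf]

lemma integral_odd {f : ℝ → ℝ} (hf : ∀ v, f (-v) = -f v) : ∫ v, f v = 0 := by
  have := integral_neg_eq_self f volume
  simp only [hf, integral_neg] at this
  linarith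

lemma continuous_rotatedExp (x α : ℝ) : Continuous (rotatedExp x α) := by
  unfold rotatedExp; fun_prop

lemma rotatedExp_neg (x α v : ℝ) : rotatedExp x α (-v) = rotatedExp x α v := by
  simp [rotatedExp]

lemma abs_rotatedExp_le (x α v : ℝ) :
    |rotatedExp x α v| ≤ Real.exp (-(x * Real.cos α) * Real.cosh v) := by
  rw [rotatedExp, abs_mul, Real.abs_exp]
  exact mul_le_of_le_one_right (Real.exp_pos _).le (Real.abs_cos_le_one _)

lemma integrable_rotatedExp {x α : ℝ} (hx : 0 < x) (hα : |α| < Real.pi / 2) :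
    Integrable (rotatedExp x α) :=
  (integrable_exp_neg_mul_cosh (mul_pos hx (cos_pos_of_abs_lt hα))).mono'
    (continuous_rotatedExp x α).aestronglyMeasurable (.of_forall (abs_rotatedExp_le x α))

lemma macdonaldIntegrand_re (x τ α v : ℝ) :
    (macdonaldIntegrand x τ (v + α * Complex.I)).re = Real.exp (-(τ * α)) *
      (Real.exp (-(x * Real.cos α) * Real.cosh v) *
        (Real.cos (x * Real.sin α * Real.sinh v) * Real.cos (τ * v)
         + Real.sin (x * Real.sin α * Real.sinh v) * Real.sin (τ * v))) := by
  rw [macdonaldIntegrand, cosh_add_mul_I, Complex.exp_re]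
  have h1 : (-(x : ℂ) * ((Real.cosh v * Real.cos α : ℝ) + (Real.sinh v * Real.sin α : ℝ) * Complex.I)
    + Complex.I * τ * (v + α * Complex.I)).re = -(τ * α) + -(x * Real.cos α) * Real.cosh v := by
    simp [-Complex.ofReal_cos, -Complex.ofReal_sin, -Complex.ofReal_cosh, -Complex.ofReal_sinh]
    ring
  have h2 : (-(x : ℂ) * ((Real.cosh v * Real.cos α : ℝ) + (Real.sinh v * Real.sin α : ℝ) * Complex.I)
    + Complex.I * τ * (v + α * Complex.I)).im = τ * v - x * Real.sin α * Real.sinh v := by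
    simp [-Complex.ofReal_cos, -Complex.ofReal_sin, -Complex.ofReal_cosh, -Complex.ofReal_sinh]
    ring
  rw [h1, h2, Real.exp_add, Real.cos_sub]
  ring

lemma klKernel_eq_integral (x τ : ℝ) :
    2 * klKernel x τ = ∫ u, Real.exp (-x * Real.cosh u) * Real.cos (τ * u) := by
  rw [integral_even (by simp), klKernel]

/-- Cosine transform of `Re exp (-x cosh (v + iα))`. -/
lemma integral_rotatedExp_mul_cos {x α : ℝ} (hx : 0 < x) (hα : |α| < Real.pi / 2) (τ : ℝ) :
    ∫ v, rotatedExp x α v * Real.cos (τ * v) = 2 * (Real.cosh (α * τ) * klKernel x τ) := by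
  have hre (β : ℝ) (hβ : |β| < Real.pi / 2) :
      ∫ v : ℝ, (macdonaldIntegrand x τ (v + β * Complex.I)).re = 2 * klKernel x τ := by
    have h0 : ∫ v : ℝ, (macdonaldIntegrand x τ (v + β * Complex.I)).re
        = (∫ v : ℝ, macdonaldIntegrand x τ (v + β * Complex.I)).re :=
      integral_re (integrable_macdonaldIntegrand hx hβ)
    have h1 : ∫ v : ℝ, (macdonaldIntegrand x τ v).re = (∫ v : ℝ, macdonaldIntegrand x τ v).re := by
      refine integral_re (𝕜 := ℂ) ?_
      simpa using integrable_macdonaldIntegrand (τ := τ) (α := 0) hx (by simp [Real.pi_pos])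
    rw [h0, integral_macdonaldIntegrand_eq hx hβ, ← h1, klKernel_eq_integral]
    congr 1; ext v
    have := macdonaldIntegrand_re x τ 0 v
    simpa using this
  have hα' : |-α| < Real.pi / 2 := by rwa [abs_neg]
  -- Averaging the heights `α` and `-α` with weights `exp(±τα)` cancels the sine products; the
  -- weights themselves add up to `2 cosh(ατ)`.
  have e1 : ∫ v : ℝ, Real.exp (τ * α) * (macdonaldIntegrand x τ (v + α * Complex.I)).re
        + Real.exp (-(τ * α)) * (macdonaldIntegrand x τ (v + (-α : ℝ) * Complex.I)).re
      = (Real.exp (τ * α) + Real.exp (-(τ * α))) * (2 * klKernel x τ) := by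
    rw [integral_add, integral_const_mul, integral_const_mul, hre _ hα, hre _ hα']
    · ring
    · exact (integrable_macdonaldIntegrand hx hα).re.const_mul _
    · exact (integrable_macdonaldIntegrand hx hα').re.const_mul _
  have e2 : ∀ v : ℝ, Real.exp (τ * α) * (macdonaldIntegrand x τ (v + α * Complex.I)).re
        + Real.exp (-(τ * α)) * (macdonaldIntegrand x τ (v + (-α : ℝ) * Complex.I)).re
        = 2 * (rotatedExp x α v * Real.cos (τ * v)) := by
    intro v
    rw [macdonaldIntegrand_re, macdonaldIntegrand_re, rotatedExp]
    have : Real.exp (τ * α) * Real.exp (-(τ * α)) = 1 := by rw [← Real.exp_add]; simp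
    simp only [mul_neg, neg_neg, Real.cos_neg, Real.sin_neg, neg_mul]
    linear_combination (2 * Real.exp (-(x * Real.cos α * Real.cosh v)) *
      Real.cos (x * Real.sin α * Real.sinh v) * Real.cos (τ * v)) * this
  simp_rw [e2] at e1
  rw [integral_const_mul] at e1
  rw [Real.cosh_eq, mul_comm α τ]
  linarith

/-- The modulus of a cosine transform is at most the `L¹` norm. Since `α` is free below `π/2`, this
encodes the exponential decay of `K_{iτ}(x)` in `τ`. -/
lemma abs_cosh_mul_klKernel_le {x α : ℝ} (hx : 0 < x) (hα : |α| < Real.pi / 2) (τ : ℝ) :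
    |Real.cosh (α * τ) * klKernel x τ| ≤ ∫ v, Real.exp (-(x * Real.cos α) * Real.cosh v) := by
  have h1 : |∫ v, rotatedExp x α v * Real.cos (τ * v)|
      ≤ ∫ v, Real.exp (-(x * Real.cos α) * Real.cosh v) := by
    rw [← Real.norm_eq_abs]
    refine norm_integral_le_of_norm_le
      (integrable_exp_neg_mul_cosh (mul_pos hx (cos_pos_of_abs_lt hα))) (.of_forall fun v => ?_)
    rw [norm_mul, Real.norm_eq_abs, Real.norm_eq_abs]
    exact (mul_le_of_le_one_right (abs_nonneg _) (Real.abs_cos_le_one _)).trans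
      (abs_rotatedExp_le x α v)
  rw [integral_rotatedExp_mul_cos hx hα, abs_mul, abs_two] at h1
  have := abs_nonneg (Real.cosh (α * τ) * klKernel x τ)
  linarith

lemma continuous_klKernel {x : ℝ} (hx : 0 < x) : Continuous (klKernel x) := by
  unfold klKernel
  refine continuous_of_dominated (bound := fun u => Real.exp (-x * Real.cosh u))
    (fun τ => by fun_prop) (fun τ => .of_forall fun u => ?_)
    (integrable_exp_neg_mul_cosh hx).integrableOn (.of_forall fun u => by fun_prop)
  rw [norm_mul, Real.norm_eq_abs, Real.abs_exp, Real.norm_eq_abs]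
  exact mul_le_of_le_one_right (Real.exp_pos _).le (Real.abs_cos_le_one _)

lemma cosh_le_exp_abs (y : ℝ) : Real.cosh y ≤ Real.exp |y| := by
  rw [← Real.cosh_abs, Real.cosh_eq]
  have := Real.exp_le_exp.2 (show -|y| ≤ |y| by linarith [abs_nonneg y])
  linarith

lemma exp_abs_le_two_mul_cosh (y : ℝ) : Real.exp |y| ≤ 2 * Real.cosh y := by
  rw [← Real.cosh_abs, Real.cosh_eq]
  have := Real.exp_pos (-|y|)
  linarith

/-- A bound for `cosh (ατ) K_{iτ}(x)`, integrable in `τ` and uniform in `x ≥ 1`. -/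
lemma abs_cosh_mul_klKernel_le_exp {x α β : ℝ} (hx : 1 ≤ x) (hα : |α| ≤ β)
    (hβ : β < Real.pi / 2) (τ : ℝ) :
    |Real.cosh (α * τ) * klKernel x τ|
      ≤ 2 * (∫ v, Real.exp (-(Real.cos β) * Real.cosh v)) * Real.exp (-(β - |α|) * |τ|) := by
  have hβ0 : 0 ≤ β := (abs_nonneg α).trans hα
  have hβ' : |β| < Real.pi / 2 := by rwa [abs_of_nonneg hβ0]
  have hc := cos_pos_of_abs_lt hβ'
  have h1 := abs_cosh_mul_klKernel_le (by linarith : 0 < x) hβ' τ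
  have h2 : ∫ v, Real.exp (-(x * Real.cos β) * Real.cosh v)
      ≤ ∫ v, Real.exp (-(Real.cos β) * Real.cosh v) := by
    refine integral_mono (integrable_exp_neg_mul_cosh (by positivity))
      (integrable_exp_neg_mul_cosh hc) fun v => ?_
    have := Real.cosh_pos v
    have : Real.cos β * Real.cosh v ≤ x * Real.cos β * Real.cosh v := by
      have : 0 < Real.cos β * Real.cosh v := by positivity
      nlinarith
    simp only [Real.exp_le_exp]
    linarith
  rw [abs_mul, abs_of_pos (Real.cosh_pos _)] at h1 ⊢
  -- The larger angle `β` pays for `cosh(ατ)` and leaves the decay rate `β - |α|`.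
  have h3 : Real.cosh (α * τ) ≤ 2 * Real.exp (-(β - |α|) * |τ|) * Real.cosh (β * τ) := by
    have e1 := cosh_le_exp_abs (α * τ)
    have e2 := exp_abs_le_two_mul_cosh (β * τ)
    rw [abs_mul] at e1 e2
    rw [abs_of_nonneg hβ0] at e2
    have : Real.exp (|α| * |τ|) = Real.exp (-(β - |α|) * |τ|) * Real.exp (β * |τ|) := by
      rw [← Real.exp_add]; ring_nf
    have := mul_le_mul_of_nonneg_left e2 (Real.exp_pos (-(β - |α|) * |τ|)).le
    linarith
  calc _ ≤ (2 * Real.exp (-(β - |α|) * |τ|) * Real.cosh (β * τ)) * |klKernel x τ| := by gcongr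
    _ = 2 * Real.exp (-(β - |α|) * |τ|) * (Real.cosh (β * τ) * |klKernel x τ|) := by ring
    _ ≤ 2 * Real.exp (-(β - |α|) * |τ|) * ∫ v, Real.exp (-(Real.cos β) * Real.cosh v) := by
        gcongr; exact h1.trans h2
    _ = _ := by ring

lemma integrable_exp_neg_mul_abs {c : ℝ} (hc : 0 < c) :
    Integrable fun τ : ℝ => Real.exp (-c * |τ|) := by
  rw [← integrableOn_univ, ← Set.Iic_union_Ioi (a := (0 : ℝ))]
  refine IntegrableOn.union ?_ ?_
  · refine (integrableOn_exp_mul_Iic hc 0).congr_fun (fun y hy => ?_) measurableSet_Iic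
    simp [abs_of_nonpos (Set.mem_Iic.1 hy)]
  · refine (exp_neg_integrableOn_Ioi 0 hc).congr_fun (fun y hy => ?_) measurableSet_Ioi
    simp [abs_of_pos (Set.mem_Ioi.1 hy)]

/-! ### Fourier inversion for even functions. -/

lemma integral_cexp_smul_of_even {f : ℝ → ℝ} (hf : Integrable f) (heven : ∀ v, f (-v) = f v)
    (c : ℝ) :
    ∫ v, Complex.exp ((c * v : ℝ) * Complex.I) * (f v : ℂ)
      = ((∫ v, f v * Real.cos (c * v) : ℝ) : ℂ) := by
  have hc : Integrable fun v => f v * Real.cos (c * v) :=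
    hf.mul_bdd (c := 1) (by fun_prop) (.of_forall fun v => Real.abs_cos_le_one _)
  have hs : Integrable fun v => f v * Real.sin (c * v) :=
    hf.mul_bdd (c := 1) (by fun_prop) (.of_forall fun v => Real.abs_sin_le_one _)
  have h0 : ∫ v, f v * Real.sin (c * v) = 0 := integral_odd (by simp [heven])
  have h1 : ∀ v, Complex.exp ((c * v : ℝ) * Complex.I) * (f v : ℂ)
      = ((f v * Real.cos (c * v) : ℝ) : ℂ) + ((f v * Real.sin (c * v) : ℝ) : ℂ) * Complex.I := by
    intro v
    rw [Complex.exp_mul_I]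
    push_cast; ring
  simp_rw [h1]
  rw [integral_add hc.ofReal (hs.ofReal.mul_const _), integral_mul_const, integral_complex_ofReal,
    integral_complex_ofReal, h0]
  simp

lemma continuous_cosh_mul_klKernel {x : ℝ} (hx : 0 < x) (α : ℝ) :
    Continuous fun τ => Real.cosh (α * τ) * klKernel x τ :=
  (by fun_prop : Continuous fun τ => Real.cosh (α * τ)).mul (continuous_klKernel hx)

lemma integrable_cosh_mul_klKernel {x α : ℝ} (hx : 1 ≤ x) (hα : |α| < Real.pi / 2) :
    Integrable fun τ => Real.cosh (α * τ) * klKernel x τ := by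
  obtain ⟨β, hβ1, hβ2⟩ := exists_between hα
  exact ((integrable_exp_neg_mul_abs (sub_pos.2 hβ1)).const_mul _).mono'
    (continuous_cosh_mul_klKernel (by linarith) α).aestronglyMeasurable
    (.of_forall fun τ => abs_cosh_mul_klKernel_le_exp hx hβ1.le hβ2 τ)

lemma klKernel_neg (x τ : ℝ) : klKernel x (-τ) = klKernel x τ := by
  simp [klKernel]

/-- Fourier inversion for the cosine transform of an even function. -/
lemma cosine_inversion {f g : ℝ → ℝ} (hfc : Continuous f) (hf : Integrable f)
    (hg : Integrable g) (hfe : ∀ v, f (-v) = f v) (hge : ∀ v, g (-v) = g v)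
    (hfg : ∀ τ, ∫ v, f v * Real.cos (τ * v) = 2 * g τ) (u : ℝ) :
    ∫ τ, g τ * Real.cos (u * τ) = Real.pi * f u := by
  -- The Fourier character is `exp(-2πi v ξ)`, so frequency `ξ` corresponds to `τ = 2πξ`.
  have hF : FourierTransform.fourier (fun v => (f v : ℂ))
      = fun ξ => ((2 * g (2 * Real.pi * ξ) : ℝ) : ℂ) := by
    ext ξ
    rw [Real.fourier_real_eq_integral_exp_smul]
    have : ∀ v : ℝ, Complex.exp (((-2 * Real.pi * v * ξ : ℝ) : ℂ) * Complex.I) • (f v : ℂ)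
        = Complex.exp (((-2 * Real.pi * ξ) * v : ℝ) * Complex.I) * (f v : ℂ) := by
      intro v; rw [smul_eq_mul]; congr 4; ring
    simp_rw [this]
    rw [integral_cexp_smul_of_even hf hfe, hfg, ← hge]
    simp
  have hg' : Integrable fun ξ => 2 * g (2 * Real.pi * ξ) :=
    (hg.comp_mul_left' (by positivity)).const_mul 2
  have hinv := congrFun (Continuous.fourierInv_fourier_eq (f := fun v => (f v : ℂ))
    (by fun_prop) hf.ofReal (by rw [hF]; exact hg'.ofReal)) u
  rw [hF, Real.fourierInv_eq'] at hinv
  have : ∀ v : ℝ, Complex.exp (((2 * Real.pi * inner ℝ v u : ℝ) : ℂ) * Complex.I)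
        • ((2 * g (2 * Real.pi * v) : ℝ) : ℂ)
      = Complex.exp (((2 * Real.pi * u) * v : ℝ) * Complex.I)
        * ((2 * g (2 * Real.pi * v) : ℝ) : ℂ) := by
    intro v; rw [smul_eq_mul]; congr 4; simp; ring
  simp_rw [this] at hinv
  rw [integral_cexp_smul_of_even hg' (by simp [hge])] at hinv
  have h2 : ∫ v, 2 * g (2 * Real.pi * v) * Real.cos (2 * Real.pi * u * v) = f u := by
    exact_mod_cast hinv
  have h3 : ∫ v, 2 * g (2 * Real.pi * v) * Real.cos (2 * Real.pi * u * v)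
      = ∫ v, (fun τ => 2 * (g τ * Real.cos (u * τ))) ((2 * Real.pi) * v) := by
    congr 1; ext v; simp only; rw [mul_assoc]; congr 3; ring
  rw [h3, Measure.integral_comp_mul_left (fun τ => 2 * (g τ * Real.cos (u * τ))),
    integral_const_mul] at h2
  rw [← h2, abs_of_pos (by positivity)]
  simp only [smul_eq_mul]
  field_simp

/-- The inverse cosine transform recovering `Re exp (-x cosh (u + iα))`. -/
lemma integral_cosh_mul_klKernel_mul_cos {x α : ℝ} (hx : 1 ≤ x) (hα : |α| < Real.pi / 2)
    (u : ℝ) :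
    ∫ τ in Set.Ioi (0 : ℝ), Real.cosh (α * τ) * klKernel x τ * Real.cos (u * τ)
      = Real.pi / 2 * rotatedExp x α u := by
  have hx0 : 0 < x := by linarith
  have := cosine_inversion (continuous_rotatedExp x α) (integrable_rotatedExp hx0 hα)
    (integrable_cosh_mul_klKernel hx hα) (rotatedExp_neg x α) (by simp [klKernel_neg])
    (integral_rotatedExp_mul_cos hx0 hα) u
  rw [integral_even (by simp [klKernel_neg])] at this
  linarith

/-- The sine part of the expanded cosine vanishes by parity. The factor `cos(uτ)` is thus encoded as
a translation by `u`, so truncation in `τ` becomes a Dirichlet kernel centred at `u`. -/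
lemma integral_rotatedExp_shift_mul_cos {x α : ℝ} (hx : 0 < x) (hα : |α| < Real.pi / 2)
    (u τ : ℝ) :
    ∫ s, rotatedExp x α (u + s) * Real.cos (τ * s)
      = 2 * (Real.cosh (α * τ) * klKernel x τ * Real.cos (u * τ)) := by
  have hint := integrable_rotatedExp hx hα
  have h1 : ∫ s, rotatedExp x α (u + s) * Real.cos (τ * s)
      = ∫ v, rotatedExp x α v * Real.cos (τ * (v - u)) := by
    rw [← integral_add_left_eq_self (fun v => rotatedExp x α v * Real.cos (τ * (v - u))) u]
    simp
  have h2 : ∀ v, rotatedExp x α v * Real.cos (τ * (v - u))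
      = rotatedExp x α v * Real.cos (τ * v) * Real.cos (u * τ)
        + rotatedExp x α v * Real.sin (τ * v) * Real.sin (u * τ) := by
    intro v
    rw [mul_sub, Real.cos_sub, mul_comm u τ]; ring
  simp_rw [h1, h2]
  rw [integral_add, integral_mul_const, integral_mul_const, integral_rotatedExp_mul_cos hx hα,
    integral_odd (f := fun v => rotatedExp x α v * Real.sin (τ * v)) (by simp [rotatedExp_neg])]
  · ring
  · exact (hint.mul_bdd (c := 1) (by fun_prop)
      (.of_forall fun v => Real.abs_cos_le_one _)).mul_const _
  · exact (hint.mul_bdd (c := 1) (by fun_prop)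
      (.of_forall fun v => Real.abs_sin_le_one _)).mul_const _

/-- The truncated inverse cosine transform in terms of the Dirichlet kernel. -/
lemma truncated_cosine_inversion {x α : ℝ} (hx : 0 < x) (hα : |α| < Real.pi / 2)
    (u N : ℝ) (hN : 0 ≤ N) :
    ∫ τ in (0 : ℝ)..N, Real.cosh (α * τ) * klKernel x τ * Real.cos (u * τ)
      = 1 / 2 * ∫ s, rotatedExp x α (u + s) * (N * Real.sinc (N * s)) := by
  have h1 : ∀ τ, Real.cosh (α * τ) * klKernel x τ * Real.cos (u * τ)
      = 1 / 2 * ∫ s, rotatedExp x α (u + s) * Real.cos (τ * s) := by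
    intro τ; rw [integral_rotatedExp_shift_mul_cos hx hα]; ring
  simp_rw [h1]
  rw [intervalIntegral.integral_const_mul, intervalIntegral.integral_of_le hN,
    integral_integral_swap]
  · congr 1
    refine integral_congr_ae (.of_forall fun s => ?_)
    simp only
    rw [integral_const_mul, ← intervalIntegral.integral_of_le hN]
    congr 1
    -- The inner integral is `sin(Ns)/s`; writing it with `sinc` keeps the formula correct at `s =
    -- 0`.
    rcases eq_or_ne s 0 with rfl | hs
    · simp
    · rw [intervalIntegral.integral_comp_mul_right _ hs]
      rcases eq_or_ne N 0 with rfl | hN'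
      · simp
      · rw [Real.sinc_of_ne_zero (mul_ne_zero hN' hs)]
        simp
        field_simp
  · have hi : Integrable (fun s => rotatedExp x α (u + s)) :=
      (integrable_rotatedExp hx hα).comp_add_left u
    exact (hi.comp_snd (volume.restrict (Set.Ioc 0 N))).mul_bdd (c := 1)
      (by fun_prop) (.of_forall fun v => Real.abs_cos_le_one _)

/-! ### Oscillatory integrals and localisation. -/

/-- Second derivative test of van der Corput. -/
lemma abs_integral_sin_le_of_second_deriv {φ φ' φ'' : ℝ → ℝ} {a b l : ℝ} (hab : a ≤ b)
    (hl : 0 < l) (h1 : ∀ s, HasDerivAt φ (φ' s) s) (h2 : ∀ s, HasDerivAt φ' (φ'' s) s)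
    (hc : Continuous φ'') (hφ : ∀ s ∈ Set.Icc a b, l ≤ φ'' s) :
    |∫ s in a..b, Real.sin (φ s)| ≤ (1 + 2 * Real.pi) / √l := by
  have c1 : Continuous φ := continuous_iff_continuousAt.2 fun s => (h1 s).continuousAt
  have c2 : Continuous φ' := continuous_iff_continuousAt.2 fun s => (h2 s).continuousAt
  have hd : ∀ s, 0 < φ' s ^ 2 + l := fun s => by positivity
  have hd0 : ∀ s, φ' s ^ 2 + l ≠ 0 := fun s => (hd s).ne'
  -- `q` is a regularised `1/φ'`, free of poles at stationary points, so the interval need not be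
  -- split. Differentiating `-cos φ · q` gives `sin φ` up to the error `r`, and `|r| ≤ 2g` where `g`
  -- is the derivative of `arctan(φ'/√l)/√l`.
  set q : ℝ → ℝ := fun s => φ' s / (φ' s ^ 2 + l) with hq
  set q' : ℝ → ℝ := fun s => φ'' s * (l - φ' s ^ 2) / (φ' s ^ 2 + l) ^ 2 with hq'
  set r : ℝ → ℝ := fun s => Real.cos (φ s) * q' s + l * Real.sin (φ s) / (φ' s ^ 2 + l) with hr
  set g : ℝ → ℝ := fun s => φ'' s / (φ' s ^ 2 + l) with hg
  have cq' : Continuous q' := by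
    refine Continuous.div (by fun_prop) (by fun_prop) fun s => pow_ne_zero _ (hd0 s)
  have cr : Continuous r := by
    refine (by fun_prop : Continuous fun s => Real.cos (φ s) * q' s).add ?_
    exact Continuous.div (by fun_prop) (by fun_prop) hd0
  have cg : Continuous g := Continuous.div (by fun_prop) (by fun_prop) hd0
  have hsl : 0 < √l := Real.sqrt_pos.2 hl
  have hsq : √l ^ 2 = l := Real.sq_sqrt hl.le
  have dq : ∀ s, HasDerivAt q (q' s) s := by
    intro s
    refine HasDerivAt.congr_deriv ((h2 s).div (((h2 s).pow 2).add_const l) (hd0 s)) ?_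
    simp only [hq']
    congr 1
    push_cast
    ring
  have dF : ∀ s, HasDerivAt (fun s => -Real.cos (φ s) * q s) (Real.sin (φ s) - r s) s := by
    intro s
    refine HasDerivAt.congr_deriv (((h1 s).cos.neg).mul (dq s)) ?_
    simp only [hr, hq, hq']
    have := hd0 s
    field_simp
    simp
    ring
  have dA : ∀ s, HasDerivAt (fun s => (√l)⁻¹ * Real.arctan (φ' s / √l)) (g s) s := by
    intro s
    refine HasDerivAt.congr_deriv ((((h2 s).div_const (√l)).arctan).const_mul ((√l)⁻¹)) ?_
    have := hd0 s
    have h3 : 1 + (φ' s / √l) ^ 2 = (φ' s ^ 2 + l) / l := by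
      rw [div_pow, hsq]; field_simp; ring
    simp only [hg]
    rw [h3]
    field_simp
    rw [hsq]
  have i1 : ∫ s in a..b, (Real.sin (φ s) - r s) = -Real.cos (φ b) * q b - -Real.cos (φ a) * q a :=
    intervalIntegral.integral_eq_sub_of_hasDerivAt (fun s _ => dF s)
      (Continuous.intervalIntegrable (by fun_prop) _ _)
  have i2 : ∫ s in a..b, g s
      = (√l)⁻¹ * Real.arctan (φ' b / √l) - (√l)⁻¹ * Real.arctan (φ' a / √l) :=
    intervalIntegral.integral_eq_sub_of_hasDerivAt (fun s _ => dA s)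
      (cg.intervalIntegrable _ _)
  rw [intervalIntegral.integral_sub (Continuous.intervalIntegrable (by fun_prop) _ _)
    (cr.intervalIntegrable _ _)] at i1
  have hrg : |∫ s in a..b, r s| ≤ ∫ s in a..b, 2 * g s := by
    rw [← Real.norm_eq_abs]
    refine intervalIntegral.norm_integral_le_of_norm_le hab (.of_forall fun s hs => ?_)
      ((cg.const_mul 2).intervalIntegrable _ _)
    have hs' := hφ s ⟨hs.1.le, hs.2⟩
    have hg0 : 0 ≤ φ'' s := hl.le.trans hs'
    have e1 : |Real.cos (φ s) * q' s| ≤ g s := by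
      rw [abs_mul]
      refine (mul_le_of_le_one_left (abs_nonneg _) (Real.abs_cos_le_one _)).trans ?_
      simp only [hq', hg]
      rw [abs_div, abs_mul, abs_of_nonneg hg0, abs_of_pos (pow_pos (hd s) 2),
        div_le_div_iff₀ (pow_pos (hd s) 2) (hd s)]
      have : |l - φ' s ^ 2| ≤ φ' s ^ 2 + l := by
        rw [abs_le]; constructor <;> nlinarith [sq_nonneg (φ' s)]
      calc _ ≤ φ'' s * (φ' s ^ 2 + l) * (φ' s ^ 2 + l) := by
            gcongr
        _ = _ := by ring
    have e2 : |l * Real.sin (φ s) / (φ' s ^ 2 + l)| ≤ g s := by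
      rw [abs_div, abs_mul, abs_of_pos hl, abs_of_pos (hd s)]
      simp only [hg]
      have := hd s
      gcongr
      exact (mul_le_of_le_one_right hl.le (Real.abs_sin_le_one _)).trans hs'
    rw [Real.norm_eq_abs]
    exact (abs_add_le _ _).trans (by linarith)
  rw [intervalIntegral.integral_const_mul, i2] at hrg
  -- This is `2√l |φ'| ≤ φ'² + l`. The two endpoints give the `1` in the constant, and twice the
  -- arctangent's range gives the `2π`.
  have hqb : ∀ s, |Real.cos (φ s) * q s| ≤ 1 / 2 * (√l)⁻¹ := by
    intro s
    rw [abs_mul]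
    refine (mul_le_of_le_one_left (abs_nonneg _) (Real.abs_cos_le_one _)).trans ?_
    simp only [hq]
    rw [abs_div, abs_of_pos (hd s), div_le_iff₀ (hd s), ← div_eq_mul_inv, div_mul_eq_mul_div,
      le_div_iff₀ hsl]
    have := sq_nonneg (|φ' s| - √l)
    have h4 := sq_abs (φ' s)
    nlinarith
  have a1 := Real.arctan_lt_pi_div_two (φ' b / √l)
  have a2 := Real.neg_pi_div_two_lt_arctan (φ' a / √l)
  have a3 : (√l)⁻¹ * Real.arctan (φ' b / √l) - (√l)⁻¹ * Real.arctan (φ' a / √l)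
      ≤ (√l)⁻¹ * Real.pi := by
    rw [← mul_sub]; gcongr; linarith
  have b1 := abs_le.1 (hqb a)
  have b2 := abs_le.1 (hqb b)
  have b3 := abs_le.1 hrg
  have : (1 + 2 * Real.pi) / √l = (√l)⁻¹ + 2 * ((√l)⁻¹ * Real.pi) := by
    rw [div_eq_mul_inv]; ring
  rw [this, abs_le]
  constructor <;> linarith

/-- Inserting a nonnegative decreasing amplitude in an integral whose primitives are bounded. -/
lemma abs_integral_mul_le_of_antitone {f ψ ψ' : ℝ → ℝ} {a b C : ℝ} (hab : a ≤ b)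
    (hf : Continuous f) (hψ : ∀ s ∈ Set.Icc a b, HasDerivAt ψ (ψ' s) s)
    (hψ' : ContinuousOn ψ' (Set.Icc a b)) (hneg : ∀ s ∈ Set.Icc a b, ψ' s ≤ 0)
    (hb : 0 ≤ ψ b) (hC : ∀ t ∈ Set.Icc a b, |∫ s in a..t, f s| ≤ C) :
    |∫ s in a..b, ψ s * f s| ≤ C * ψ a := by
  have hu : Set.uIcc a b = Set.Icc a b := Set.uIcc_of_le hab
  have hi : IntervalIntegrable ψ' volume a b := by
    rw [← hu] at hψ'; exact hψ'.intervalIntegrable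
  have key := intervalIntegral.integral_mul_deriv_eq_deriv_mul (a := a) (b := b)
    (u := ψ) (u' := ψ') (v := fun t => ∫ s in a..t, f s) (v' := f)
    (by rw [hu]; exact hψ) (fun t _ => intervalIntegral.integral_hasDerivAt_right
      (hf.intervalIntegrable _ _) (hf.stronglyMeasurableAtFilter _ _) hf.continuousAt)
    hi (hf.intervalIntegrable _ _)
  -- After integration by parts the variation of `ψ` contributes `C (ψ a - ψ b)`, and the boundary
  -- term at `b` contributes `C ψ b`.
  have h1 : |∫ t in a..b, ψ' t * ∫ s in a..t, f s| ≤ ∫ t in a..b, C * -ψ' t := by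
    rw [← Real.norm_eq_abs]
    refine intervalIntegral.norm_integral_le_of_norm_le hab (.of_forall fun t ht => ?_)
      (hi.neg.const_mul C)
    have ht' : t ∈ Set.Icc a b := ⟨ht.1.le, ht.2⟩
    rw [norm_mul, Real.norm_eq_abs, Real.norm_eq_abs, abs_of_nonpos (hneg t ht'), mul_comm C]
    exact mul_le_mul_of_nonneg_left (hC t ht') (by linarith [hneg t ht'])
  have h2 : ∫ t in a..b, ψ' t = ψ b - ψ a :=
    intervalIntegral.integral_eq_sub_of_hasDerivAt (by rw [hu]; exact hψ) hi
  rw [intervalIntegral.integral_const_mul, intervalIntegral.integral_neg, h2] at h1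
  rw [key]
  simp only [intervalIntegral.integral_same, mul_zero, sub_zero]
  have h3 : |ψ b * ∫ s in a..b, f s| ≤ ψ b * C := by
    rw [abs_mul, abs_of_nonneg hb]
    exact mul_le_mul_of_nonneg_left (hC b ⟨hab, le_rfl⟩) hb
  refine (abs_sub _ _).trans ?_
  linarith

lemma hasDerivAt_sinh_add_mul (A N u s : ℝ) :
    HasDerivAt (fun s => A * Real.sinh (u + s) + N * s) (A * Real.cosh (u + s) + N) s := by
  have h1 : HasDerivAt (fun s => u + s) 1 s := by simpa using (hasDerivAt_id s).const_add u
  have h2 := ((h1.sinh).const_mul A).add ((hasDerivAt_id s).const_mul N)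
  exact h2.congr_deriv (by simp)

/-- The linear term `N s` disappears from the second derivative `A sinh(u+s)` of the phase, so the
bound is uniform in `N`. -/
lemma abs_integral_sin_sinh_le {A N u a b l : ℝ} (hA : 0 < A) (hl : 0 < l) (hab : a ≤ b)
    (ha : l ≤ u + a) :
    |∫ s in a..b, Real.sin (A * Real.sinh (u + s) + N * s)|
      ≤ (1 + 2 * Real.pi) / √(A * Real.sinh l) := by
  refine abs_integral_sin_le_of_second_deriv (φ'' := fun s => A * Real.sinh (u + s)) hab
    (mul_pos hA (Real.sinh_pos_iff.2 hl)) (hasDerivAt_sinh_add_mul A N u) (fun s => ?_)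
    (by fun_prop) fun s hs => ?_
  · have h1 : HasDerivAt (fun s => u + s) 1 s := by simpa using (hasDerivAt_id s).const_add u
    simpa using ((h1.cosh).const_mul A).add_const N
  · have : l ≤ u + s := by linarith [hs.1]
    have := Real.sinh_le_sinh.2 this
    gcongr

lemma abs_integral_sin_mul_cos_sinh_le {A N u a b l : ℝ} (hA : 0 < A) (hl : 0 < l) (hab : a ≤ b)
    (ha : l ≤ u + a) :
    |∫ s in a..b, Real.cos (A * Real.sinh (u + s)) * Real.sin (N * s)|
      ≤ (1 + 2 * Real.pi) / √(A * Real.sinh l) := by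
  have h1 : ∀ s, Real.cos (A * Real.sinh (u + s)) * Real.sin (N * s)
      = 1 / 2 * (Real.sin (A * Real.sinh (u + s) + N * s)
          - Real.sin (A * Real.sinh (u + s) + -N * s)) := by
    intro s
    rw [neg_mul, ← sub_eq_add_neg, Real.sin_add, Real.sin_sub]
    ring
  simp_rw [h1]
  rw [intervalIntegral.integral_const_mul, intervalIntegral.integral_sub
    (Continuous.intervalIntegrable (by fun_prop) _ _)
    (Continuous.intervalIntegrable (by fun_prop) _ _), abs_mul]
  have e1 := abs_integral_sin_sinh_le (N := N) hA hl hab ha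
  have e2 := abs_integral_sin_sinh_le (N := -N) hA hl hab ha
  have e3 := abs_sub (∫ s in a..b, Real.sin (A * Real.sinh (u + s) + N * s))
    (∫ s in a..b, Real.sin (A * Real.sinh (u + s) + -N * s))
  rw [abs_of_pos (by norm_num : (0 : ℝ) < 1 / 2)]
  linarith

lemma mul_sinc_eq_div (N : ℝ) {s : ℝ} (hs : s ≠ 0) :
    N * Real.sinc (N * s) = Real.sin (N * s) / s := by
  rcases eq_or_ne N 0 with rfl | hN
  · simp
  · rw [Real.sinc_of_ne_zero (mul_ne_zero hN hs)]
    field_simp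

/-- The amplitude `exp(-c cosh(u+s))/s` decreases because `u + s > 0` on the range. The exponential
is used only through monotonicity and the bound `1`, so the estimate survives `cos α → 0`. -/
lemma abs_interval_integral_rotatedExp_mul_sinc_le {x α N u R b l : ℝ} (hx : 0 < x)
    (hα0 : 0 < α) (hα : α < Real.pi / 2) (hR : 1 ≤ R) (hl : 0 < l) (hb : R ≤ b)
    (hlu : l ≤ u + R) :
    |∫ s in R..b, rotatedExp x α (u + s) * (N * Real.sinc (N * s))|
      ≤ (1 + 2 * Real.pi) / √(x * Real.sin α * Real.sinh l) * R⁻¹ := by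
  have hA : 0 < x * Real.sin α :=
    mul_pos hx (Real.sin_pos_of_pos_of_lt_pi hα0 (by linarith [Real.pi_pos]))
  have hc : 0 < x * Real.cos α := mul_pos hx (cos_pos_of_abs_lt (by rwa [abs_of_pos hα0]))
  set c := x * Real.cos α with hc_def
  set ψ : ℝ → ℝ := fun s => Real.exp (-c * Real.cosh (u + s)) / s with hψ
  set ψ' : ℝ → ℝ := fun s => (Real.exp (-c * Real.cosh (u + s)) * (-c * Real.sinh (u + s)) * s
    - Real.exp (-c * Real.cosh (u + s))) / s ^ 2 with hψ'
  have h1 : ∫ s in R..b, rotatedExp x α (u + s) * (N * Real.sinc (N * s))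
      = ∫ s in R..b, ψ s * (Real.cos (x * Real.sin α * Real.sinh (u + s)) * Real.sin (N * s)) := by
    refine intervalIntegral.integral_congr fun s hs => ?_
    rw [Set.uIcc_of_le hb] at hs
    have hs0 : s ≠ 0 := by linarith [hs.1]
    simp only [mul_sinc_eq_div N hs0, rotatedExp, hψ]
    ring
  have hC : 0 ≤ (1 + 2 * Real.pi) / √(x * Real.sin α * Real.sinh l) := by positivity
  have h2 := abs_integral_mul_le_of_antitone (ψ := ψ) (ψ' := ψ') hb
    (f := fun s => Real.cos (x * Real.sin α * Real.sinh (u + s)) * Real.sin (N * s))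
    (by fun_prop) (fun s hs => ?_) ?_ (fun s hs => ?_) ?_
    (fun t ht => abs_integral_sin_mul_cos_sinh_le hA hl ht.1 hlu)
  · rw [h1]
    refine h2.trans ?_
    gcongr
    simp only [hψ]
    rw [div_eq_mul_inv]
    refine mul_le_of_le_one_left (by positivity) ?_
    rw [Real.exp_le_one_iff]
    have := Real.cosh_pos (u + R)
    nlinarith
  · have hs0 : s ≠ 0 := by linarith [hs.1]
    have e1 : HasDerivAt (fun s => u + s) 1 s := by simpa using (hasDerivAt_id s).const_add u
    have e2 := ((e1.cosh.const_mul (-c)).exp).div (hasDerivAt_id s) hs0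
    refine e2.congr_deriv ?_
    simp [hψ']
  · have : ∀ s ∈ Set.Icc R b, s ^ 2 ≠ 0 := fun s hs => pow_ne_zero _ (by linarith [hs.1])
    exact ContinuousOn.div (by fun_prop) (by fun_prop) this
  · have hs1 : 0 < s := by linarith [hs.1]
    have hsh : 0 ≤ Real.sinh (u + s) := Real.sinh_nonneg_iff.2 (by linarith [hs.1])
    refine div_nonpos_of_nonpos_of_nonneg ?_ (by positivity)
    have e := Real.exp_pos (-c * Real.cosh (u + s))
    have : 0 ≤ Real.exp (-c * Real.cosh (u + s)) * (c * Real.sinh (u + s)) * s := by positivity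
    nlinarith
  · have : 0 < b := by linarith
    positivity

lemma integrable_rotatedExp_shift_mul_sinc {x α : ℝ} (hx : 0 < x) (hα : |α| < Real.pi / 2)
    (u N : ℝ) : Integrable fun s => rotatedExp x α (u + s) * (N * Real.sinc (N * s)) := by
  have hi : Integrable (fun s => rotatedExp x α (u + s)) :=
    (integrable_rotatedExp hx hα).comp_add_left u
  refine hi.mul_bdd (c := |N|) (Continuous.aestronglyMeasurable ?_) (.of_forall fun s => ?_)
  · exact continuous_const.mul (Real.continuous_sinc.comp (by fun_prop))
  · rw [norm_mul, Real.norm_eq_abs]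
    exact mul_le_of_le_one_right (abs_nonneg _) (Real.abs_sinc_le_one _)

lemma abs_integral_Ioi_rotatedExp_mul_sinc_le {x α N u R l : ℝ} (hx : 0 < x)
    (hα0 : 0 < α) (hα : α < Real.pi / 2) (hR : 1 ≤ R) (hl : 0 < l) (hlu : l ≤ u + R) :
    |∫ s in Set.Ioi R, rotatedExp x α (u + s) * (N * Real.sinc (N * s))|
      ≤ (1 + 2 * Real.pi) / √(x * Real.sin α * Real.sinh l) * R⁻¹ := by
  have hint := integrable_rotatedExp_shift_mul_sinc hx
    (by rwa [abs_of_pos hα0] : |α| < Real.pi / 2) u N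
  have ht := (intervalIntegral_tendsto_integral_Ioi R hint.integrableOn tendsto_id).abs
  refine le_of_tendsto ht ?_
  filter_upwards [eventually_ge_atTop R] with b hb
  exact abs_interval_integral_rotatedExp_mul_sinc_le hx hα0 hα hR hl hb hlu

lemma integral_eq_three_pieces {f : ℝ → ℝ} (hf : Integrable f) (R : ℝ) :
    ∫ s, f s = (∫ s in (-R)..R, f s) + (∫ s in Set.Ioi R, f s)
      + ∫ s in Set.Ioi R, f (-s) := by
  rw [integral_comp_neg_Ioi, ← intervalIntegral.integral_Iic_add_Ioi (b := R) hf.integrableOn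
    hf.integrableOn, ← intervalIntegral.integral_Iic_sub_Iic hf.integrableOn hf.integrableOn]
  ring

/-- Localisation of the truncated cosine inversion, uniform in the angle and the cut-off. -/
lemma abs_truncated_sub_local_le {x α N u R w : ℝ} (hx : 0 < x)
    (hα0 : 0 < α) (hα : α < Real.pi / 2) (hN : 0 ≤ N) (hR : 1 ≤ R) (hw : w < R)
    (hu : |u| ≤ w) :
    |(∫ τ in (0 : ℝ)..N, Real.cosh (α * τ) * klKernel x τ * Real.cos (u * τ))
      - 1 / 2 * ∫ s in (-R)..R, rotatedExp x α (u + s) * (N * Real.sinc (N * s))|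
      ≤ (1 + 2 * Real.pi) / √(x * Real.sin α * Real.sinh (R - w)) * R⁻¹ := by
  have hα' : |α| < Real.pi / 2 := by rwa [abs_of_pos hα0]
  have hu' := abs_le.1 hu
  rw [truncated_cosine_inversion hx hα' u N hN, integral_eq_three_pieces
    (integrable_rotatedExp_shift_mul_sinc hx hα' u N) R]
  have e1 := abs_integral_Ioi_rotatedExp_mul_sinc_le (N := N) (u := u) hx hα0 hα hR
    (sub_pos.2 hw) (by linarith)
  have e2 := abs_integral_Ioi_rotatedExp_mul_sinc_le (N := N) (u := -u) hx hα0 hα hR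
    (sub_pos.2 hw) (by linarith)
  -- Reflection turns the left tail at `u` into the right tail at `-u`; the condition `|u| ≤ w` is
  -- symmetric.
  have h3 : ∀ s, rotatedExp x α (u + -s) * (N * Real.sinc (N * -s))
      = rotatedExp x α (-u + s) * (N * Real.sinc (N * s)) := by
    intro s
    rw [← rotatedExp_neg x α (u + -s), mul_neg, Real.sinc_neg]
    ring_nf
  simp_rw [h3]
  rw [abs_le] at e1 e2 ⊢
  constructor <;> linarith

lemma continuous_interval_integral_of_uncurry {f : ℝ → ℝ → ℝ}
    (hf : Continuous (Function.uncurry f)) (a b : ℝ) :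
    Continuous fun y => ∫ s in a..b, f y s :=
  intervalIntegral.continuous_parametric_intervalIntegral_of_continuous' hf a b

/-- The localisation estimate in the limiting case of a right angle. -/
lemma abs_truncated_sub_local_le_right_angle {x N u R w : ℝ} (hx : 0 < x)
    (hN : 0 ≤ N) (hR : 1 ≤ R) (hw : w < R) (hu : |u| ≤ w) :
    |(∫ τ in (0 : ℝ)..N, Real.cosh (Real.pi / 2 * τ) * klKernel x τ * Real.cos (u * τ))
      - 1 / 2 * ∫ s in (-R)..R, Real.cos (x * Real.sinh (u + s)) * (N * Real.sinc (N * s))|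
      ≤ (1 + 2 * Real.pi) / √(x * Real.sinh (R - w)) * R⁻¹ := by
  have hk := continuous_klKernel hx
  have hsi := Real.continuous_sinc
  have c1 : Continuous fun α => ∫ τ in (0 : ℝ)..N,
      Real.cosh (α * τ) * klKernel x τ * Real.cos (u * τ) :=
    continuous_interval_integral_of_uncurry (by unfold Function.uncurry; fun_prop) _ _
  have c2 : Continuous fun α => ∫ s in (-R)..R,
      rotatedExp x α (u + s) * (N * Real.sinc (N * s)) :=
    continuous_interval_integral_of_uncurry
      (by unfold Function.uncurry rotatedExp; fun_prop) _ _
  -- With `N` and `R` fixed both integrals run over bounded intervals, hence are continuous in `α`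
  -- up to `π/2`.
  have t1 := ((c1.sub (c2.const_mul (1 / 2))).abs.tendsto (Real.pi / 2)).mono_left
    (nhdsWithin_le_nhds (s := Set.Iio (Real.pi / 2)))
  have hsh : 0 < Real.sinh (R - w) := Real.sinh_pos_iff.2 (sub_pos.2 hw)
  have t2 : Tendsto (fun α => (1 + 2 * Real.pi) / √(x * Real.sin α * Real.sinh (R - w)) * R⁻¹)
      (𝓝[<] (Real.pi / 2)) (𝓝 ((1 + 2 * Real.pi) / √(x * Real.sinh (R - w)) * R⁻¹)) := by
    have : ContinuousAt (fun α => (1 + 2 * Real.pi) / √(x * Real.sin α * Real.sinh (R - w)) * R⁻¹)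
        (Real.pi / 2) := by
      refine ContinuousAt.mul (ContinuousAt.div (by fun_prop) (by fun_prop) ?_) continuousAt_const
      rw [Real.sin_pi_div_two, mul_one]
      positivity
    have := this.tendsto.mono_left (nhdsWithin_le_nhds (s := Set.Iio (Real.pi / 2)))
    simpa using this
  have h := le_of_tendsto_of_tendsto t1 t2 (by
    filter_upwards [Ioo_mem_nhdsLT (show (0 : ℝ) < Real.pi / 2 by positivity)] with α hα
    exact abs_truncated_sub_local_le hx hα.1 hα.2 hN hR hw hu)
  simpa [rotatedExp] using h

/-! ### Riemann-Lebesgue and the Dirichlet integral. -/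

/-- Riemann-Lebesgue lemma for the sine transform. -/
lemma tendsto_integral_mul_sin {f : ℝ → ℝ} {S : Set ℝ} (hS : MeasurableSet S)
    (hf : IntegrableOn f S) :
    Tendsto (fun N : ℝ => ∫ s in S, f s * Real.sin (N * s)) atTop (𝓝 0) := by
  have hi : Integrable (S.indicator f) := (integrable_indicator_iff hS).2 hf
  have h1 := Real.tendsto_integral_exp_smul_cocompact (fun s => ((S.indicator f s : ℝ) : ℂ))
  have h2 : Tendsto (fun N : ℝ => N / (2 * Real.pi)) atTop (cocompact ℝ) :=
    (tendsto_id.atTop_div_const (by positivity)).mono_right atTop_le_cocompact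
  have h3 := (Complex.continuous_im.tendsto _).comp (h1.comp h2)
  have h4 : ∀ N : ℝ, (∫ v, Real.fourierChar (-(v * (N / (2 * Real.pi))))
      • ((S.indicator f v : ℝ) : ℂ)).im = -∫ s in S, f s * Real.sin (N * s) := by
    intro N
    have e1 : ∀ v : ℝ, Real.fourierChar (-(v * (N / (2 * Real.pi))))
      • ((S.indicator f v : ℝ) : ℂ)
        = Complex.exp ((-N * v : ℝ) * Complex.I) * ((S.indicator f v : ℝ) : ℂ) := by
      intro v
      rw [Circle.smul_def, Real.fourierChar_apply, smul_eq_mul]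
      congr 4
      field_simp
    have e2 : Integrable fun v : ℝ =>
        Complex.exp ((-N * v : ℝ) * Complex.I) * ((S.indicator f v : ℝ) : ℂ) := by
      refine hi.ofReal.bdd_mul (c := 1) (by fun_prop) (.of_forall fun v => ?_)
      rw [Complex.norm_exp_ofReal_mul_I]
    simp_rw [e1]
    have e3 : (∫ v : ℝ, Complex.exp ((-N * v : ℝ) * Complex.I) * ((S.indicator f v : ℝ) : ℂ)).im
        = ∫ v : ℝ, (Complex.exp ((-N * v : ℝ) * Complex.I) * ((S.indicator f v : ℝ) : ℂ)).im :=
      (integral_im (𝕜 := ℂ) e2).symm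
    rw [e3, ← integral_neg, ← integral_indicator hS]
    refine integral_congr_ae (.of_forall fun v => ?_)
    simp only [Complex.im_mul_ofReal, Complex.exp_ofReal_mul_I_im]
    by_cases hv : v ∈ S <;> simp [hv, mul_comm]
  have h5 : Tendsto (fun N : ℝ => -∫ s in S, f s * Real.sin (N * s)) atTop (𝓝 0) := by
    refine (h3.congr fun N => ?_)
    exact h4 N
  simpa using h5.neg

lemma tendsto_interval_integral_mul_sin {f : ℝ → ℝ} {a b : ℝ} (hab : a ≤ b)
    (hf : IntervalIntegrable f volume a b) :
    Tendsto (fun N : ℝ => ∫ s in a..b, f s * Real.sin (N * s)) atTop (𝓝 0) := by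
  simp_rw [intervalIntegral.integral_of_le hab]
  exact tendsto_integral_mul_sin measurableSet_Ioc
    ((intervalIntegrable_iff_integrableOn_Ioc_of_le hab).1 hf)

lemma continuous_dslope_of_differentiable {g : ℝ → ℝ} (hg : Differentiable ℝ g) :
    Continuous (dslope g 0) := by
  rw [← continuousOn_univ, continuousOn_dslope Filter.univ_mem]
  exact ⟨hg.continuous.continuousOn, hg 0⟩

/-- Splitting off the value at the centre of the Dirichlet kernel. -/
lemma integral_mul_sinc_eq {g : ℝ → ℝ} (hg : Differentiable ℝ g) (N R : ℝ) :
    ∫ s in (-R)..R, g s * (N * Real.sinc (N * s))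
      = g 0 * (∫ s in (-R)..R, N * Real.sinc (N * s))
        + ∫ s in (-R)..R, dslope g 0 s * Real.sin (N * s) := by
  have hsi := Real.continuous_sinc
  have hd := continuous_dslope_of_differentiable hg
  rw [← intervalIntegral.integral_const_mul, ← intervalIntegral.integral_add
    (Continuous.intervalIntegrable (by fun_prop) _ _)
    (Continuous.intervalIntegrable (by fun_prop) _ _)]
  refine intervalIntegral.integral_congr fun s _ => ?_
  have h := sub_smul_dslope g 0 s
  simp only [sub_zero, smul_eq_mul] at h
  rcases eq_or_ne s 0 with rfl | hs
  · simp
  · simp only [mul_sinc_eq_div N hs]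
    field_simp
    linear_combination (-Real.sin (N * s)) * h

/-- This is the inversion formula at `x = 1`, `α = 0`, `u = 0`, where everything is absolutely
integrable. Since the limit is known here, the value of the Dirichlet integral can be read off from
it. -/
lemma tendsto_integral_klKernel_one :
    Tendsto (fun N : ℝ => ∫ s, rotatedExp 1 0 s * (N * Real.sinc (N * s))) atTop
      (𝓝 (Real.pi * Real.exp (-1))) := by
  have h0 : |(0 : ℝ)| < Real.pi / 2 := by simp [Real.pi_pos]
  have h1 : IntegrableOn (fun τ => Real.cosh (0 * τ) * klKernel 1 τ * Real.cos (0 * τ))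
      (Set.Ioi 0) := by
    simpa using (integrable_cosh_mul_klKernel le_rfl h0).integrableOn
  have h2 := (intervalIntegral_tendsto_integral_Ioi 0 h1 tendsto_id).const_mul 2
  rw [integral_cosh_mul_klKernel_mul_cos le_rfl h0] at h2
  have e : 2 * (Real.pi / 2 * rotatedExp 1 0 0) = Real.pi * Real.exp (-1) := by
    simp [rotatedExp]; ring
  rw [e] at h2
  refine h2.congr' ?_
  filter_upwards [eventually_ge_atTop 0] with N hN
  simp only [id]
  rw [truncated_cosine_inversion one_pos h0 0 N hN]
  simp

/-- The Dirichlet integral. -/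
lemma tendsto_integral_mul_sinc_one :
    Tendsto (fun N : ℝ => ∫ s in (-1 : ℝ)..1, N * Real.sinc (N * s)) atTop (𝓝 Real.pi) := by
  have h0 : |(0 : ℝ)| < Real.pi / 2 := by simp [Real.pi_pos]
  have hrot : ∀ s, rotatedExp 1 0 s = Real.exp (-Real.cosh s) := fun s => by simp [rotatedExp]
  have hdiff : Differentiable ℝ fun s => rotatedExp 1 0 s := by
    simp_rw [hrot]
    exact Real.differentiable_cosh.neg.exp
  have hd := continuous_dslope_of_differentiable hdiff
  have t1 := tendsto_interval_integral_mul_sin (f := dslope (fun s => rotatedExp 1 0 s) 0)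
    (by norm_num : (-1 : ℝ) ≤ 1) (hd.intervalIntegrable _ _)
  have hint : IntegrableOn (fun s => rotatedExp 1 0 s * s⁻¹) (Set.Ioi 1) := by
    refine Integrable.mono' (integrable_rotatedExp one_pos h0).norm.integrableOn ?_ ?_
    · exact ((continuous_rotatedExp 1 0).measurable.mul measurable_inv).aestronglyMeasurable
    · refine (ae_restrict_iff' measurableSet_Ioi).2 (.of_forall fun s hs => ?_)
      rw [norm_mul]
      refine mul_le_of_le_one_right (norm_nonneg _) ?_
      have hs' : (1 : ℝ) < s := hs
      rw [norm_inv, Real.norm_eq_abs, abs_of_pos (by linarith)]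
      exact inv_le_one_of_one_le₀ hs'.le
  have t2 := tendsto_integral_mul_sin measurableSet_Ioi hint
  -- The difference-quotient part and the two equal tails vanish by Riemann-Lebesgue. What remains
  -- is `exp(-1)` times the Dirichlet integral, whence the factor `exp 1`.
  have t3 := ((tendsto_integral_klKernel_one.sub t1).sub (t2.const_mul 2)).const_mul (Real.exp 1)
  have e : Real.exp 1 * (Real.pi * Real.exp (-1) - 0 - 2 * 0) = Real.pi := by
    have : Real.exp 1 * Real.exp (-1) = 1 := by rw [← Real.exp_add]; simp
    linear_combination Real.pi * this
  rw [e] at t3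
  refine t3.congr fun N => ?_
  have h3 := integral_eq_three_pieces (by
    simpa using integrable_rotatedExp_shift_mul_sinc (N := N) one_pos h0 0) 1
  have h4 : ∫ s in Set.Ioi (1 : ℝ), rotatedExp 1 0 s * (N * Real.sinc (N * s))
      = ∫ s in Set.Ioi (1 : ℝ), rotatedExp 1 0 s * s⁻¹ * Real.sin (N * s) := by
    refine setIntegral_congr_fun measurableSet_Ioi fun s hs => ?_
    have hs' : (1 : ℝ) < s := hs
    simp only [mul_sinc_eq_div N (by linarith : s ≠ 0)]
    ring
  simp only [mul_neg, Real.sinc_neg, rotatedExp_neg, h4] at h3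
  have h5 := integral_mul_sinc_eq hdiff N 1
  rw [h5, hrot 0, Real.cosh_zero] at h3
  have : Real.exp 1 * Real.exp (-1) = 1 := by rw [← Real.exp_add]; simp
  rw [h3]
  linear_combination (∫ s in (-1 : ℝ)..1, N * Real.sinc (N * s)) * this

lemma integral_mul_sinc_scale (N R : ℝ) :
    ∫ s in (-R)..R, N * Real.sinc (N * s)
      = ∫ s in (-1 : ℝ)..1, (R * N) * Real.sinc ((R * N) * s) := by
  have := intervalIntegral.mul_integral_comp_mul_left (a := -1) (b := 1)
    (f := fun s => N * Real.sinc (N * s)) R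
  simp only [mul_neg, mul_one] at this
  rw [← this, ← intervalIntegral.integral_const_mul]
  congr 1; ext s; ring_nf

lemma tendsto_integral_mul_sinc {R : ℝ} (hR : 0 < R) :
    Tendsto (fun N : ℝ => ∫ s in (-R)..R, N * Real.sinc (N * s)) atTop (𝓝 Real.pi) := by
  simp_rw [fun N => integral_mul_sinc_scale N R]
  exact tendsto_integral_mul_sinc_one.comp (tendsto_id.const_mul_atTop hR)

/-- The truncated Dirichlet integrals are bounded. -/
lemma exists_bound_integral_mul_sinc {R : ℝ} (hR : 0 < R) :
    ∃ C, ∀ N, 0 ≤ N → |∫ s in (-R)..R, N * Real.sinc (N * s)| ≤ C := by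
  have h := (tendsto_integral_mul_sinc hR).abs.eventually_lt_const
    (show |Real.pi| < |Real.pi| + 1 by linarith)
  obtain ⟨N₀, hN₀⟩ := eventually_atTop.1 h
  -- Convergence controls `N ≥ N₀`; below that the kernel is at most `N₀` on an interval of length
  -- `2R`.
  refine ⟨max (|Real.pi| + 1) (N₀ * (2 * R)), fun N hN => ?_⟩
  rcases le_total N₀ N with h1 | h1
  · exact (hN₀ N h1).le.trans (le_max_left _ _)
  · refine le_trans ?_ (le_max_right _ _)
    have := intervalIntegral.norm_integral_le_of_norm_le_const (a := -R) (b := R) (C := N₀)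
      (f := fun s => N * Real.sinc (N * s)) (fun s _ => by
        rw [norm_mul, Real.norm_eq_abs, Real.norm_eq_abs, abs_of_nonneg hN]
        exact (mul_le_of_le_one_right hN (Real.abs_sinc_le_one _)).trans h1)
    rw [Real.norm_eq_abs] at this
    refine this.trans_eq ?_
    rw [abs_of_pos (by linarith)]; ring

/-! ### Convergence of truncated inversion at the right angle. -/

/-- The inverse cosine transform of `cosh (πτ/2) K_{iτ}(x)` truncated at `N`. -/
noncomputable def truncatedInverse (x N u : ℝ) : ℝ :=
  ∫ τ in (0 : ℝ)..N, Real.cosh (Real.pi / 2 * τ) * klKernel x τ * Real.cos (u * τ)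

lemma differentiable_cos_sinh (x u : ℝ) :
    Differentiable ℝ fun s => Real.cos (x * Real.sinh (u + s)) :=
  (((Real.differentiable_sinh.comp (differentiable_id.const_add u))).const_mul x).cos

/-- This Lipschitz constant bounds the difference quotient uniformly in `u`, as the uniform bound on
the truncated inverses requires. -/
lemma abs_cos_sinh_sub_le {x u w R s : ℝ} (hx : 0 < x) (hu : |u| ≤ w) (hs : |s| ≤ R) :
    |Real.cos (x * Real.sinh (u + s)) - Real.cos (x * Real.sinh (u + 0))|
      ≤ x * Real.cosh (w + R) * |s| := by
  have hd : ∀ t, HasDerivAt (fun s => Real.cos (x * Real.sinh (u + s)))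
      (-Real.sin (x * Real.sinh (u + t)) * (x * Real.cosh (u + t))) t := by
    intro t
    have h1 : HasDerivAt (fun s => u + s) 1 t := by simpa using (hasDerivAt_id t).const_add u
    exact ((h1.sinh.const_mul x).cos).congr_deriv (by simp)
  have := (convex_Icc (-R) R).norm_image_sub_le_of_norm_hasDerivWithin_le
    (C := x * Real.cosh (w + R)) (fun t _ => (hd t).hasDerivWithinAt) (fun t ht => ?_)
    (x := 0) (y := s) ⟨by linarith [abs_nonneg s], by linarith [abs_nonneg s]⟩ (abs_le.1 hs)
  · simpa using this
  · rw [norm_mul, norm_neg, Real.norm_eq_abs, Real.norm_eq_abs, abs_mul, abs_of_pos hx,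
      abs_of_pos (Real.cosh_pos _)]
    refine (mul_le_of_le_one_left (mul_pos hx (Real.cosh_pos _)).le (Real.abs_sin_le_one _)).trans ?_
    refine mul_le_mul_of_nonneg_left (Real.cosh_le_cosh.2 ?_) hx.le
    exact (abs_add_le _ _).trans ((add_le_add hu (abs_le.2 ht)).trans (le_abs_self _))

lemma tail_bound_le {x R w : ℝ} (hx : 0 < x) (hR : w + 1 ≤ R) (hR0 : 0 < R) :
    (1 + 2 * Real.pi) / √(x * Real.sinh (R - w)) * R⁻¹
      ≤ (1 + 2 * Real.pi) / √(x * Real.sinh 1) * R⁻¹ := by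
  have h1 : Real.sinh 1 ≤ Real.sinh (R - w) := Real.sinh_le_sinh.2 (by linarith)
  have h2 : 0 < Real.sinh 1 := Real.sinh_pos_iff.2 one_pos
  gcongr

/-- The order of choices matters: `R` is fixed first, making the tails small for every `N ≥ 0`, and
only then does `N → ∞` in the local integral. -/
lemma tendsto_truncatedInverse {x : ℝ} (hx : 0 < x) (u : ℝ) :
    Tendsto (fun N => truncatedInverse x N u) atTop
      (𝓝 (Real.pi / 2 * Real.cos (x * Real.sinh u))) := by
  rw [Metric.tendsto_nhds]
  intro ε hε
  set K := (1 + 2 * Real.pi) / √(x * Real.sinh 1) with hK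
  have hK0 : 0 ≤ K := by positivity
  obtain ⟨R, hR1, hR2⟩ : ∃ R : ℝ, |u| + 1 ≤ R ∧ K * R⁻¹ < ε / 2 := by
    have h : Tendsto (fun R : ℝ => K * R⁻¹) atTop (𝓝 0) := by
      simpa using tendsto_inv_atTop_zero.const_mul K
    exact ((eventually_ge_atTop (|u| + 1)).and
      (h.eventually_lt_const (half_pos hε))).exists
  have hu0 := abs_nonneg u
  have hR0 : 0 < R := by linarith
  set g : ℝ → ℝ := fun s => Real.cos (x * Real.sinh (u + s)) with hg
  have hdiff : Differentiable ℝ g := differentiable_cos_sinh x u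
  have t1 := tendsto_interval_integral_mul_sin (by linarith : -R ≤ R)
    ((continuous_dslope_of_differentiable hdiff).intervalIntegrable _ _)
  have t2 := ((((tendsto_integral_mul_sinc hR0).const_mul (g 0)).add t1).const_mul (1 / 2))
  have e : 1 / 2 * (g 0 * Real.pi + 0) = Real.pi / 2 * Real.cos (x * Real.sinh u) := by
    simp [hg]; ring
  rw [e] at t2
  filter_upwards [(Metric.tendsto_nhds.1 t2) (ε / 2) (half_pos hε), eventually_ge_atTop 0]
    with N hN hN0
  rw [← integral_mul_sinc_eq hdiff] at hN
  have h3 := (abs_truncated_sub_local_le_right_angle hx hN0 (by linarith : 1 ≤ R)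
    (by linarith : |u| < R) le_rfl).trans (tail_bound_le hx hR1 hR0)
  refine (dist_triangle _ _ _).trans_lt ((add_lt_add_of_le_of_lt ?_ hN).trans_eq (add_halves ε))
  exact h3.trans hR2.le

/-- The truncated inverse transforms are uniformly bounded on bounded sets. -/
lemma exists_bound_truncatedInverse {x : ℝ} (hx : 0 < x) {w : ℝ} (hw : 0 ≤ w) :
    ∃ C, ∀ N, 0 ≤ N → ∀ u, |u| ≤ w → |truncatedInverse x N u| ≤ C := by
  obtain ⟨C, hC⟩ := exists_bound_integral_mul_sinc (by linarith : 0 < w + 1)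
  -- The radius is `w + 1`, so that `R - w = 1`. The terms are the tail bound, the Dirichlet bound
  -- `C` (as `|g 0| ≤ 1`), and the Lipschitz constant times the interval length.
  refine ⟨(1 + 2 * Real.pi) / √(x * Real.sinh 1) * (w + 1)⁻¹
    + 1 / 2 * (C + x * Real.cosh (w + (w + 1)) * |(w + 1) - -(w + 1)|), fun N hN u hu => ?_⟩
  have h3 := (abs_truncated_sub_local_le_right_angle hx hN (by linarith : 1 ≤ w + 1)
    (by linarith) hu).trans (tail_bound_le hx le_rfl (by linarith))
  rw [integral_mul_sinc_eq (differentiable_cos_sinh x u)] at h3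
  set g : ℝ → ℝ := fun s => Real.cos (x * Real.sinh (u + s)) with hg
  have h4 : |∫ s in (-(w + 1))..(w + 1), dslope g 0 s * Real.sin (N * s)|
      ≤ x * Real.cosh (w + (w + 1)) * |(w + 1) - -(w + 1)| := by
    rw [← Real.norm_eq_abs]
    refine intervalIntegral.norm_integral_le_of_norm_le_const fun s hs => ?_
    rw [Set.uIoc_of_le (by linarith)] at hs
    have hL : 0 ≤ x * Real.cosh (w + (w + 1)) := (mul_pos hx (Real.cosh_pos _)).le
    rcases eq_or_ne s 0 with rfl | hs0
    · simpa using hL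
    · have h5 := abs_cos_sinh_sub_le (s := s) (R := w + 1) hx hu (abs_le.2 ⟨hs.1.le, hs.2⟩)
      rw [norm_mul, Real.norm_eq_abs, Real.norm_eq_abs]
      refine (mul_le_of_le_one_right (abs_nonneg _) (Real.abs_sin_le_one _)).trans ?_
      have h6 := sub_smul_dslope g 0 s
      rw [sub_zero, smul_eq_mul] at h6
      have h7 : |s| * |dslope g 0 s| ≤ x * Real.cosh (w + (w + 1)) * |s| := by
        rw [← abs_mul, h6]; exact h5
      have : 0 < |s| := abs_pos.2 hs0
      nlinarith
  have h5 : |g 0 * ∫ s in (-(w + 1))..(w + 1), N * Real.sinc (N * s)| ≤ C := by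
    rw [abs_mul]
    exact (mul_le_of_le_one_left (abs_nonneg _) (Real.abs_cos_le_one _)).trans (hC N hN)
  have h6 := (abs_add_le _ _).trans (add_le_add h5 h4)
  have h7 := abs_add_le _ _ |>.trans (add_le_add h3 ((abs_mul (1 / 2 : ℝ) _).le.trans
    (mul_le_mul_of_nonneg_left h6 (abs_nonneg _))))
  rwa [sub_add_cancel, abs_of_pos (by norm_num : (0 : ℝ) < 1 / 2)] at h7

lemma continuous_truncatedInverse {x : ℝ} (hx : 0 < x) (N : ℝ) :
    Continuous (truncatedInverse x N) := by
  have hk := continuous_klKernel hx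
  exact continuous_interval_integral_of_uncurry (by unfold Function.uncurry; fun_prop) _ _

lemma interval_integral_swap_of_continuous {f : ℝ → ℝ → ℂ}
    (hf : Continuous (Function.uncurry f)) {a b c d : ℝ} (hab : a ≤ b) (hcd : c ≤ d) :
    ∫ x in a..b, ∫ y in c..d, f x y = ∫ y in c..d, ∫ x in a..b, f x y := by
  simp only [intervalIntegral.integral_of_le hab, intervalIntegral.integral_of_le hcd]
  refine integral_integral_swap ?_
  rw [Measure.prod_restrict]
  exact ((hf.continuousOn.integrableOn_compact (isCompact_Icc.prod isCompact_Icc)).mono_set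
    (Set.prod_mono Set.Ioc_subset_Icc_self Set.Ioc_subset_Icc_self))

/-- Parseval-type limit for the kernel `cosh (πτ/2) K_{iτ}(x)`. -/
lemma tendsto_integral_cosh_mul_klKernel_mul {x : ℝ} (hx : 0 < x) {H : ℝ → ℂ}
    (hH : Continuous H) {w : ℝ} (hw : 0 ≤ w) :
    Tendsto (fun N : ℝ => ∫ τ in (0 : ℝ)..N,
        ((Real.cosh (Real.pi / 2 * τ) * klKernel x τ : ℝ) : ℂ)
          * ∫ u in (0 : ℝ)..w, H u * (Real.cos (u * τ) : ℂ)) atTop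
      (𝓝 (∫ u in (0 : ℝ)..w, H u * ((Real.pi / 2 * Real.cos (x * Real.sinh u) : ℝ) : ℂ))) := by
  have hk := continuous_klKernel hx
  obtain ⟨C, hC⟩ := exists_bound_truncatedInverse hx hw
  have h1 : ∀ N, 0 ≤ N → ∫ u in (0 : ℝ)..w, H u * (truncatedInverse x N u : ℂ)
      = ∫ τ in (0 : ℝ)..N, ((Real.cosh (Real.pi / 2 * τ) * klKernel x τ : ℝ) : ℂ)
          * ∫ u in (0 : ℝ)..w, H u * (Real.cos (u * τ) : ℂ) := by
    intro N hN
    simp_rw [← intervalIntegral.integral_const_mul]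
    rw [interval_integral_swap_of_continuous (by unfold Function.uncurry; fun_prop) hN hw]
    refine intervalIntegral.integral_congr fun u _ => ?_
    simp only [truncatedInverse]
    rw [← intervalIntegral.integral_ofReal, ← intervalIntegral.integral_const_mul]
    refine intervalIntegral.integral_congr fun τ _ => ?_
    push_cast
    ring
  refine Tendsto.congr' ((eventually_ge_atTop 0).mono fun N hN => h1 N hN) ?_
  -- Fubini on a rectangle has moved the truncation inside, so pointwise convergence and the bound
  -- `C`, uniform for `|u| ≤ w`, suffice.
  refine intervalIntegral.tendsto_integral_filter_of_dominated_convergence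
    (fun u => ‖H u‖ * C) (.of_forall fun N => ?_) ?_ ?_ ?_
  · have := continuous_truncatedInverse hx N
    exact Continuous.aestronglyMeasurable (by fun_prop)
  · filter_upwards [eventually_ge_atTop 0] with N hN
    refine .of_forall fun u hu => ?_
    rw [Set.uIoc_of_le hw] at hu
    rw [norm_mul, Complex.norm_real, Real.norm_eq_abs]
    gcongr
    exact hC N hN u (by rw [abs_of_pos hu.1]; exact hu.2)
  · exact Continuous.intervalIntegrable (by fun_prop) _ _
  · refine .of_forall fun u _ => ?_
    exact ((Complex.continuous_ofReal.tendsto _).comp (tendsto_truncatedInverse hx u)).const_mul _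

/-! ### The incomplete kernel and orthogonality of cosines. -/

lemma macdonaldK_I_mul (x τ : ℝ) : macdonaldK (Complex.I * τ) x = klKernel x τ := by
  rw [macdonaldK, klKernel, ← integral_complex_ofReal]
  refine integral_congr_ae (.of_forall fun u => ?_)
  have : Complex.I * τ * u = (τ * u : ℝ) * Complex.I := by push_cast; ring
  simp only [this, Complex.cosh_mul_I]
  push_cast
  rfl

/-- `∫_0^{arsinh π} cosh u cos (x sinh u) cos (uτ) du`. -/
noncomputable def incompleteCos (x τ : ℝ) : ℝ :=
  ∫ u in (0 : ℝ)..Real.arsinh Real.pi, Real.cosh u * Real.cos (x * Real.sinh u) * Real.cos (u * τ)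

lemma arsinh_pi_pos : 0 < Real.arsinh Real.pi := Real.arsinh_pos_iff.2 Real.pi_pos

/-- Integration by parts. The boundary terms vanish because `sin(m sinh u)` is zero at `u = 0` and
equals `sin(mπ)` at the upper limit, with `m` an integer. -/
lemma mul_integral_sin_sinh_mul_sin (m : ℕ) (τ : ℝ) :
    τ * ∫ u in (0 : ℝ)..Real.arsinh Real.pi, Real.sin (m * Real.sinh u) * Real.sin (τ * u)
      = m * incompleteCos m τ := by
  have hu : ∀ s, HasDerivAt (fun s => Real.sin (m * Real.sinh s))
      (Real.cos (m * Real.sinh s) * (m * Real.cosh s)) s := fun s =>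
    ((Real.hasDerivAt_sinh s).const_mul (m : ℝ)).sin
  have hv : ∀ s, HasDerivAt (fun s => -Real.cos (τ * s)) (τ * Real.sin (τ * s)) s := fun s =>
    (((hasDerivAt_id s).const_mul τ).cos.neg).congr_deriv (by simp; ring)
  have key := intervalIntegral.integral_mul_deriv_eq_deriv_mul (a := 0)
    (b := Real.arsinh Real.pi) (fun s _ => hu s) (fun s _ => hv s)
    (Continuous.intervalIntegrable (by fun_prop) _ _)
    (Continuous.intervalIntegrable (by fun_prop) _ _)
  rw [Real.sinh_arsinh, Real.sin_nat_mul_pi, Real.sinh_zero, mul_zero, Real.sin_zero, zero_mul,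
    zero_mul, sub_zero, zero_sub, ← intervalIntegral.integral_neg] at key
  rw [incompleteCos, ← intervalIntegral.integral_const_mul, ← intervalIntegral.integral_const_mul]
  refine Eq.trans (intervalIntegral.integral_congr fun s _ => ?_)
    (key.trans (intervalIntegral.integral_congr fun s _ => ?_))
  · ring
  · simp only [mul_comm s τ]; ring

lemma incompleteKs_I_mul (x τ w : ℝ) :
    incompleteKs x (Complex.I * τ) w = ((Real.sinh (Real.pi * τ / 2))⁻¹ *
      ∫ u in (0 : ℝ)..w, Real.sin (x * Real.sinh u) * Real.sin (τ * u) : ℝ) := by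
  have h1 : Complex.sin (Real.pi * (Complex.I * τ) / 2)
      = (Real.sinh (Real.pi * τ / 2) : ℂ) * Complex.I := by
    have : Real.pi * (Complex.I * τ) / 2 = (Real.pi * τ / 2 : ℝ) * Complex.I := by
      push_cast; ring
    rw [this, Complex.sin_mul_I]; push_cast; rfl
  have h2 : ∫ u in (0 : ℝ)..w, (Real.sin (x * Real.sinh u) : ℂ) * Complex.sinh (Complex.I * τ * u)
      = (∫ u in (0 : ℝ)..w, Real.sin (x * Real.sinh u) * Real.sin (τ * u) : ℝ) * Complex.I := by
    rw [← intervalIntegral.integral_ofReal, ← intervalIntegral.integral_mul_const]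
    refine intervalIntegral.integral_congr fun u _ => ?_
    have : Complex.I * τ * u = (τ * u : ℝ) * Complex.I := by push_cast; ring
    simp only [this, Complex.sinh_mul_I]
    push_cast
    ring
  rw [incompleteKs, h1, h2]
  push_cast
  -- When the denominator vanishes, both sides are zero by the convention for division by zero.
  by_cases h : Complex.sinh (Real.pi * τ / 2) = 0
  · simp [h]
  · field_simp [Complex.I_ne_zero]

lemma mul_sinh_mul_incompleteKs (m : ℕ) {τ : ℝ} (hτ : 0 < τ) :
    ((τ * Real.sinh (Real.pi * τ / 2) : ℝ) : ℂ)
        * incompleteKs m (Complex.I * τ) (Real.arsinh Real.pi)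
      = ((m * incompleteCos m τ : ℝ) : ℂ) := by
  have h : Real.sinh (Real.pi * τ / 2) ≠ 0 := by
    have := Real.pi_pos
    exact (Real.sinh_pos_iff.2 (by positivity)).ne'
  rw [incompleteKs_I_mul, ← Complex.ofReal_mul, ← mul_integral_sin_sinh_mul_sin]
  congr 1
  field_simp

/-- The bound does not depend on `x`, so the series over `m` converges as soon as `∑ |a_m|` does. -/
lemma norm_incompleteKs_le (x τ : ℝ) {w : ℝ} (hw : 0 ≤ w) :
    ‖incompleteKs x (Complex.I * τ) w‖ ≤ |(Real.sinh (Real.pi * τ / 2))⁻¹| * w := by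
  rw [incompleteKs_I_mul, Complex.norm_real, Real.norm_eq_abs, abs_mul]
  have := intervalIntegral.norm_integral_le_of_norm_le_const (a := 0) (b := w) (C := 1)
    (f := fun u => Real.sin (x * Real.sinh u) * Real.sin (τ * u)) (fun u _ => by
      rw [norm_mul]
      exact mul_le_one₀ (Real.abs_sin_le_one _) (norm_nonneg _) (Real.abs_sin_le_one _))
  rw [Real.norm_eq_abs, sub_zero, abs_of_nonneg hw, one_mul] at this
  gcongr

lemma integral_cos_int_mul {k : ℤ} (hk : k ≠ 0) :
    ∫ t in (0 : ℝ)..Real.pi, Real.cos (k * t) = 0 := by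
  have hk' : (k : ℝ) ≠ 0 := by exact_mod_cast hk
  rw [intervalIntegral.integral_comp_mul_left (fun t => Real.cos t) hk', integral_cos]
  simp [Real.sin_int_mul_pi]

lemma integral_cos_mul_cos {m n : ℕ} (hm : 0 < m) :
    ∫ t in (0 : ℝ)..Real.pi, Real.cos (m * t) * Real.cos (n * t)
      = if m = n then Real.pi / 2 else 0 := by
  have h1 : ∀ t : ℝ, Real.cos (m * t) * Real.cos (n * t)
      = 1 / 2 * (Real.cos (((m - n : ℤ) : ℝ) * t) + Real.cos (((m + n : ℤ) : ℝ) * t)) := by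
    intro t
    push_cast
    rw [sub_mul, add_mul, Real.cos_sub, Real.cos_add]; ring
  simp_rw [h1]
  rw [intervalIntegral.integral_const_mul, intervalIntegral.integral_add
    (Continuous.intervalIntegrable (by fun_prop) _ _)
    (Continuous.intervalIntegrable (by fun_prop) _ _),
    integral_cos_int_mul (k := m + n) (by omega)]
  split_ifs with h
  · subst h; simp; ring
  · rw [integral_cos_int_mul (by omega)]; simp

/-- The substitution `t = sinh u` carries the range onto `[0, π]`, with `cosh u` as the Jacobian. -/
lemma integral_cosh_mul_cos_sinh_mul_cos_sinh {m n : ℕ} (hm : 0 < m) :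
    ∫ u in (0 : ℝ)..Real.arsinh Real.pi,
      Real.cosh u * Real.cos (n * Real.sinh u) * Real.cos (m * Real.sinh u)
      = if m = n then Real.pi / 2 else 0 := by
  rw [← integral_cos_mul_cos hm]
  have := intervalIntegral.integral_comp_mul_deriv (a := 0) (b := Real.arsinh Real.pi)
    (g := fun t => Real.cos (m * t) * Real.cos (n * t)) (f := Real.sinh) (f' := Real.cosh)
    (fun u _ => Real.hasDerivAt_sinh u) (by fun_prop) (by fun_prop)
  rw [Real.sinh_arsinh, Real.sinh_zero] at this
  rw [← this]
  refine intervalIntegral.integral_congr fun u _ => ?_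
  simp only [Function.comp]
  ring

lemma continuous_incompleteCos (x : ℝ) : Continuous (incompleteCos x) :=
  continuous_interval_integral_of_uncurry (by unfold Function.uncurry; fun_prop) _ _

lemma abs_interval_integral_cosh_mul_le {f : ℝ → ℝ} (hf : ∀ u, |f u| ≤ 1) :
    |∫ u in (0 : ℝ)..Real.arsinh Real.pi, Real.cosh u * f u|
      ≤ Real.cosh (Real.arsinh Real.pi) * Real.arsinh Real.pi := by
  have hw := arsinh_pi_pos
  have := intervalIntegral.norm_integral_le_of_norm_le_const (a := 0) (b := Real.arsinh Real.pi)
    (C := Real.cosh (Real.arsinh Real.pi)) (f := fun u => Real.cosh u * f u) (fun u hu => by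
      rw [Set.uIoc_of_le hw.le] at hu
      rw [norm_mul, Real.norm_eq_abs, Real.norm_eq_abs, abs_of_pos (Real.cosh_pos _)]
      refine (mul_le_of_le_one_right (Real.cosh_pos _).le (hf u)).trans ?_
      rw [Real.cosh_le_cosh, abs_of_pos hu.1, abs_of_pos hw]
      exact hu.2)
  rwa [Real.norm_eq_abs, sub_zero, abs_of_pos hw] at this

lemma abs_incompleteCos_le (x τ : ℝ) :
    |incompleteCos x τ| ≤ Real.cosh (Real.arsinh Real.pi) * Real.arsinh Real.pi := by
  simp only [incompleteCos, mul_assoc]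
  refine abs_interval_integral_cosh_mul_le fun u => ?_
  rw [abs_mul]
  exact mul_le_one₀ (Real.abs_cos_le_one _) (abs_nonneg _) (Real.abs_cos_le_one _)

/-! ### Termwise integration and the two expansions. -/

/-- Termwise integration of an absolutely convergent combination of dominated functions. -/
lemma integrableOn_tsum_and_hasSum {ι : Type*} [Countable ι] {a : ι → ℂ}
    (ha : Summable fun m => ‖a m‖) {f : ι → ℝ → ℝ} {b : ℝ → ℝ} {B : ℝ} {S : Set ℝ}
    (hf : ∀ m, Continuous (f m)) (hb : ∀ m τ, |f m τ| ≤ b τ) (hB : ∀ τ, b τ ≤ B)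
    (hbi : IntegrableOn b S) :
    IntegrableOn (fun τ => ∑' m, a m * (f m τ : ℂ)) S ∧
      HasSum (fun m => a m * ((∫ τ in S, f m τ : ℝ) : ℂ)) (∫ τ in S, ∑' m, a m * (f m τ : ℂ)) := by
  have hnorm : ∀ m τ, ‖a m * (f m τ : ℂ)‖ ≤ ‖a m‖ * b τ := by
    intro m τ
    rw [norm_mul, Complex.norm_real, Real.norm_eq_abs]
    exact mul_le_mul_of_nonneg_left (hb m τ) (norm_nonneg _)
  have hfi : ∀ m, IntegrableOn (f m) S := fun m =>
    hbi.mono' (hf m).aestronglyMeasurable (.of_forall (hb m))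
  constructor
  · have hc : Continuous fun τ => ∑' m, a m * (f m τ : ℂ) := by
      refine continuous_tsum (u := fun m => ‖a m‖ * B) (fun m => ?_) (ha.mul_right B)
        fun m τ => (hnorm m τ).trans ?_
      · have := hf m; fun_prop
      · exact mul_le_mul_of_nonneg_left (hB τ) (norm_nonneg _)
    refine (hbi.const_mul (∑' m, ‖a m‖)).mono' hc.aestronglyMeasurable (.of_forall fun τ => ?_)
    rw [← tsum_mul_right]
    exact tsum_of_norm_bounded (ha.mul_right (b τ)).hasSum fun m => hnorm m τ
  · have := hasSum_integral_of_summable_integral_norm (μ := volume.restrict S)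
      (F := fun m τ => a m * (f m τ : ℂ)) (fun m => ((hfi m).ofReal).const_mul _) ?_
    · simpa only [integral_const_mul, integral_complex_ofReal] using this
    · refine Summable.of_nonneg_of_le (fun m => integral_nonneg fun τ => norm_nonneg _)
        (fun m => ?_) (ha.mul_right (∫ τ in S, b τ))
      rw [← integral_const_mul]
      exact integral_mono (((hfi m).ofReal).const_mul (a m)).norm (hbi.const_mul _) (hnorm m)

/-- Fubini, absolutely justified by the decay in `τ` for `|α| < π/2`, places the inverse cosine
transform inside a bounded `u`-integral. -/
lemma integral_incompleteCos_mul_klKernel (n : ℝ) {x α : ℝ} (hx : 1 ≤ x)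
    (hα : |α| < Real.pi / 2) :
    ∫ τ in Set.Ioi (0 : ℝ), incompleteCos n τ * (Real.cosh (α * τ) * klKernel x τ)
      = Real.pi / 2 * ∫ u in (0 : ℝ)..Real.arsinh Real.pi,
          Real.cosh u * Real.cos (n * Real.sinh u) * rotatedExp x α u := by
  have hk := integrable_cosh_mul_klKernel hx hα
  have h1 : ∀ τ, incompleteCos n τ * (Real.cosh (α * τ) * klKernel x τ)
      = ∫ u in (0 : ℝ)..Real.arsinh Real.pi, Real.cosh u * Real.cos (n * Real.sinh u)
        * (Real.cosh (α * τ) * klKernel x τ) * Real.cos (u * τ) := by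
    intro τ
    rw [incompleteCos, ← intervalIntegral.integral_mul_const]
    refine intervalIntegral.integral_congr fun u _ => ?_
    ring
  simp_rw [h1]
  rw [← intervalIntegral_integral_swap, ← intervalIntegral.integral_const_mul]
  · refine intervalIntegral.integral_congr fun u _ => ?_
    simp only [mul_assoc]
    rw [integral_const_mul, integral_const_mul]
    have := integral_cosh_mul_klKernel_mul_cos hx hα u
    simp only [mul_assoc] at this
    rw [this]; ring
  · have hg : Integrable (fun u => Real.cosh u * Real.cos (n * Real.sinh u))
        (volume.restrict (Set.uIoc 0 (Real.arsinh Real.pi))) :=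
      (Continuous.integrableOn_uIcc (by fun_prop)).mono_set Set.uIoc_subset_uIcc
    exact (hg.mul_prod (hk.restrict (s := Set.Ioi 0))).mul_bdd (c := 1) (by fun_prop)
      (.of_forall fun p => Real.abs_cos_le_one _)

lemma abs_incompleteCos_mul_klKernel_le (n : ℝ) {x α β : ℝ} (hx : 1 ≤ x) (hα : |α| ≤ β)
    (hβ : β < Real.pi / 2) (τ : ℝ) :
    |n * (incompleteCos n τ * (Real.cosh (α * τ) * klKernel x τ))|
      ≤ |n| * (Real.cosh (Real.arsinh Real.pi) * Real.arsinh Real.pi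
        * (2 * (∫ v, Real.exp (-(Real.cos β) * Real.cosh v)) * Real.exp (-(β - |α|) * |τ|))) := by
  rw [abs_mul, abs_mul (incompleteCos n τ)]
  have := arsinh_pi_pos
  gcongr
  · exact abs_incompleteCos_le n τ
  · exact abs_cosh_mul_klKernel_le_exp hx hα hβ τ

lemma one_le_pnat_cast (m : ℕ+) : (1 : ℝ) ≤ ((m : ℕ) : ℝ) := by exact_mod_cast m.pos

lemma abel_integrand_eq (a : ℕ+ → ℂ) (n : ℕ+) (α : ℝ) {τ : ℝ} (hτ : 0 < τ) :
    ((τ * Real.sinh (Real.pi * τ / 2) * Real.cosh (α * τ) : ℝ) : ℂ) *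
        incompleteKs ((n : ℕ) : ℝ) (Complex.I * (τ : ℂ)) (Real.arsinh Real.pi) *
        ∑' m : ℕ+, a m * macdonaldK (Complex.I * (τ : ℂ)) ((m : ℕ) : ℂ)
      = ∑' m : ℕ+, a m * (((n : ℕ) * (incompleteCos (n : ℕ) τ *
          (Real.cosh (α * τ) * klKernel (m : ℕ) τ)) : ℝ) : ℂ) := by
  have h := mul_sinh_mul_incompleteKs n hτ
  rw [← tsum_mul_left]
  congr 1; ext m
  have hK := macdonaldK_I_mul ((m : ℕ) : ℝ) τ
  rw [Complex.ofReal_natCast] at hK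
  rw [hK]
  push_cast at h ⊢
  linear_combination (Complex.cosh (α * τ) * (a m * (klKernel (m : ℕ) τ : ℂ))) * h

/-- Termwise integration is allowed because the bound on the summands, taken at an angle `β` between
`α` and `π/2`, is the same for all `m ≥ 1`. -/
lemma abel_expansion {a : ℕ+ → ℂ} (ha : Summable fun m => ‖a m‖) (n : ℕ+) {α : ℝ}
    (hα0 : 0 < α) (hα : α < Real.pi / 2) :
    IntegrableOn (fun τ : ℝ => ((τ * Real.sinh (Real.pi * τ / 2) * Real.cosh (α * τ) : ℝ) : ℂ) *
        incompleteKs ((n : ℕ) : ℝ) (Complex.I * (τ : ℂ)) (Real.arsinh Real.pi) *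
        ∑' m : ℕ+, a m * macdonaldK (Complex.I * (τ : ℂ)) ((m : ℕ) : ℂ)) (Set.Ioi 0) ∧
    HasSum (fun m => a m * (((n : ℕ) * (Real.pi / 2 * ∫ u in (0 : ℝ)..Real.arsinh Real.pi,
          Real.cosh u * Real.cos ((n : ℕ) * Real.sinh u) * rotatedExp (m : ℕ) α u) : ℝ) : ℂ))
      (∫ τ in Set.Ioi (0 : ℝ),
        ((τ * Real.sinh (Real.pi * τ / 2) * Real.cosh (α * τ) : ℝ) : ℂ) *
        incompleteKs ((n : ℕ) : ℝ) (Complex.I * (τ : ℂ)) (Real.arsinh Real.pi) *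
        ∑' m : ℕ+, a m * macdonaldK (Complex.I * (τ : ℂ)) ((m : ℕ) : ℂ)) := by
  have hα' : |α| < Real.pi / 2 := by rwa [abs_of_pos hα0]
  obtain ⟨β, hβ1, hβ2⟩ := exists_between hα'
  have hw := arsinh_pi_pos
  have hI : 0 ≤ ∫ v, Real.exp (-(Real.cos β) * Real.cosh v) :=
    integral_nonneg fun v => (Real.exp_pos _).le
  obtain ⟨h1, h2⟩ := integrableOn_tsum_and_hasSum ha (S := Set.Ioi 0)
    (f := fun m : ℕ+ => fun τ => ((n : ℕ) : ℝ) * (incompleteCos (n : ℕ) τ *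
      (Real.cosh (α * τ) * klKernel (m : ℕ) τ)))
    (fun m => continuous_const.mul ((continuous_incompleteCos _).mul
      (continuous_cosh_mul_klKernel (by linarith [one_le_pnat_cast m]) α)))
    (fun m τ => abs_incompleteCos_mul_klKernel_le _ (one_le_pnat_cast m) hβ1.le hβ2 τ)
    (B := |((n : ℕ) : ℝ)| * (Real.cosh (Real.arsinh Real.pi) * Real.arsinh Real.pi
        * (2 * (∫ v, Real.exp (-(Real.cos β) * Real.cosh v)) * 1)))
    (fun τ => by
      gcongr
      rw [Real.exp_le_one_iff]
      have := sub_pos.2 hβ1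
      have := abs_nonneg τ
      nlinarith)
    ((((integrable_exp_neg_mul_abs (sub_pos.2 hβ1)).const_mul _).const_mul _).const_mul
      _).integrableOn
  have hcongr : ∀ τ ∈ Set.Ioi (0 : ℝ), _ := fun τ hτ => abel_integrand_eq a n α hτ
  refine ⟨h1.congr_fun (fun τ hτ => (hcongr τ hτ).symm) measurableSet_Ioi, ?_⟩
  rw [setIntegral_congr_fun measurableSet_Ioi hcongr]
  convert h2 using 1
  funext m
  rw [integral_const_mul, integral_incompleteCos_mul_klKernel _ (one_le_pnat_cast m) hα']

/-- A series `∑ m a_m cos (m t)` integrated against a continuous function of `u`, `t = sinh u`. -/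
lemma hasSum_integral_cos_sinh {c : ℕ+ → ℂ} (hc : Summable fun m => ‖c m‖) {g : ℝ → ℝ}
    (hg : Continuous g) (w : ℝ) :
    HasSum (fun m : ℕ+ => c m * ((∫ u in (0 : ℝ)..w,
        g u * Real.cos ((m : ℕ) * Real.sinh u) : ℝ) : ℂ))
      (∫ u in (0 : ℝ)..w, (∑' m : ℕ+, c m * (Real.cos ((m : ℕ) * Real.sinh u) : ℂ)) * (g u : ℂ)) := by
  have hle : ∀ (m : ℕ+) (u : ℝ), ‖c m * (Real.cos ((m : ℕ) * Real.sinh u) : ℂ)‖ ≤ ‖c m‖ := by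
    intro m u
    rw [norm_mul, Complex.norm_real]
    exact mul_le_of_le_one_right (norm_nonneg _) (Real.abs_cos_le_one _)
  have hs : ∀ u : ℝ, Summable fun m : ℕ+ => c m * (Real.cos ((m : ℕ) * Real.sinh u) : ℂ) :=
    fun u => Summable.of_norm_bounded hc fun m => hle m u
  have := intervalIntegral.hasSum_integral_of_dominated_convergence (μ := volume)
    (a := 0) (b := w)
    (F := fun (m : ℕ+) u => c m * (Real.cos ((m : ℕ) * Real.sinh u) : ℂ) * (g u : ℂ))
    (fun m u => ‖c m‖ * |g u|) (fun m => Continuous.aestronglyMeasurable (by fun_prop))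
    (fun m => .of_forall fun u _ => by
      rw [norm_mul, Complex.norm_real, Real.norm_eq_abs]
      exact mul_le_mul_of_nonneg_right (hle m u) (abs_nonneg _))
    (.of_forall fun u _ => hc.mul_right _)
    (by simp_rw [tsum_mul_right]; exact Continuous.intervalIntegrable (by fun_prop) _ _)
    (.of_forall fun u _ => (hs u).hasSum.mul_right _)
  have e : ∀ m : ℕ+, c m * ((∫ u in (0 : ℝ)..w, g u * Real.cos ((m : ℕ) * Real.sinh u) : ℝ) : ℂ)
      = ∫ u in (0 : ℝ)..w, c m * (Real.cos ((m : ℕ) * Real.sinh u) : ℂ) * (g u : ℂ) := by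
    intro m
    rw [← intervalIntegral.integral_ofReal, ← intervalIntegral.integral_const_mul]
    refine intervalIntegral.integral_congr fun u _ => ?_
    push_cast
    ring
  simpa only [e] using this

lemma continuous_tsum_cos_sinh {c : ℕ+ → ℂ} (hc : Summable fun m => ‖c m‖) :
    Continuous fun u : ℝ => ∑' m : ℕ+, c m * (Real.cos ((m : ℕ) * Real.sinh u) : ℂ) := by
  refine continuous_tsum (fun m => by fun_prop) hc fun m u => ?_
  rw [norm_mul, Complex.norm_real]
  exact mul_le_of_le_one_right (norm_nonneg _) (Real.abs_cos_le_one _)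

/-- In `sinh(πτ) = 2 sinh(πτ/2) cosh(πτ/2)` the first factor cancels the denominator of `K_s`, and
the second is the weight of the limiting angle. The factor `m` comes from the integration by parts.
-/
lemma improper_integrand_eq {a : ℕ+ → ℂ} (ha : Summable fun m : ℕ+ => ‖((m : ℕ) : ℂ) * a m‖)
    (n : ℕ+) {τ : ℝ} (hτ : 0 < τ) :
    ((τ * Real.sinh (Real.pi * τ) : ℝ) : ℂ) *
        macdonaldK (Complex.I * (τ : ℂ)) ((n : ℕ) : ℂ) *
        ∑' m : ℕ+,
          a m * incompleteKs ((m : ℕ) : ℝ) (Complex.I * (τ : ℂ)) (Real.arsinh Real.pi)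
      = 2 * (((Real.cosh (Real.pi / 2 * τ) * klKernel (n : ℕ) τ : ℝ) : ℂ) *
        ∫ u in (0 : ℝ)..Real.arsinh Real.pi, (∑' m : ℕ+, ((m : ℕ) : ℂ) * a m *
          (Real.cos ((m : ℕ) * Real.sinh u) : ℂ)) * (Real.cosh u : ℂ) * (Real.cos (u * τ) : ℂ)) := by
  have h1 := (hasSum_integral_cos_sinh ha (g := fun u => Real.cosh u * Real.cos (u * τ))
    (by fun_prop) (Real.arsinh Real.pi)).tsum_eq
  have h2 : ∀ m : ℕ+, ∫ u in (0 : ℝ)..Real.arsinh Real.pi,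
      Real.cosh u * Real.cos (u * τ) * Real.cos ((m : ℕ) * Real.sinh u)
      = incompleteCos (m : ℕ) τ := by
    intro m
    refine intervalIntegral.integral_congr fun u _ => ?_
    ring
  simp only [h2, Complex.ofReal_mul, ← mul_assoc] at h1
  rw [← h1, ← tsum_mul_left, ← tsum_mul_left, ← tsum_mul_left]
  congr 1; ext m
  have hK := macdonaldK_I_mul ((n : ℕ) : ℝ) τ
  rw [Complex.ofReal_natCast] at hK
  have h := mul_sinh_mul_incompleteKs m hτ
  have hs : Real.sinh (Real.pi * τ)
      = 2 * Real.sinh (Real.pi * τ / 2) * Real.cosh (Real.pi / 2 * τ) := by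
    rw [← mul_div_right_comm, ← Real.sinh_two_mul]; ring_nf
  rw [hK, hs]
  push_cast at h ⊢
  linear_combination (2 * Complex.cosh (Real.pi / 2 * τ) * (klKernel (n : ℕ) τ : ℂ) * a m) * h

/-- The `u`-range is bounded, so `α = π/2` can be inserted directly; there the rotated exponential
is `cos(m sinh u)` and orthogonality applies. -/
lemma tendsto_abel_coefficient (m n : ℕ+) :
    Tendsto (fun α => ∫ u in (0 : ℝ)..Real.arsinh Real.pi,
        Real.cosh u * Real.cos ((n : ℕ) * Real.sinh u) * rotatedExp (m : ℕ) α u)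
      (𝓝[<] (Real.pi / 2)) (𝓝 (if m = n then Real.pi / 2 else 0)) := by
  have hc : Continuous fun α => ∫ u in (0 : ℝ)..Real.arsinh Real.pi,
        Real.cosh u * Real.cos ((n : ℕ) * Real.sinh u) * rotatedExp (m : ℕ) α u :=
    continuous_interval_integral_of_uncurry
      (by unfold Function.uncurry rotatedExp; fun_prop) _ _
  have h := (hc.tendsto (Real.pi / 2)).mono_left
    (nhdsWithin_le_nhds (s := Set.Iio (Real.pi / 2)))
  have e := integral_cosh_mul_cos_sinh_mul_cos_sinh (n := n) m.pos
  simp only [PNat.coe_inj] at e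
  rw [← e]
  simpa [rotatedExp] using h

lemma tendsto_abel_expansion {a : ℕ+ → ℂ} (ha : Summable fun m => ‖a m‖) (n : ℕ+) :
    Tendsto (fun α : ℝ =>
        ((4 / (Real.pi ^ 2 * ((n : ℕ) : ℝ)) : ℝ) : ℂ) *
          ∫ τ in Set.Ioi (0 : ℝ),
            ((τ * Real.sinh (Real.pi * τ / 2) * Real.cosh (α * τ) : ℝ) : ℂ) *
              incompleteKs ((n : ℕ) : ℝ) (Complex.I * (τ : ℂ)) (Real.arsinh Real.pi) *
              ∑' m : ℕ+, a m * macdonaldK (Complex.I * (τ : ℂ)) ((m : ℕ) : ℂ))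
        (𝓝[<] (Real.pi / 2)) (𝓝 (a n)) := by
  set f : ℝ → ℕ+ → ℂ := fun α m => a m * (((n : ℕ) * (Real.pi / 2 *
    ∫ u in (0 : ℝ)..Real.arsinh Real.pi,
      Real.cosh u * Real.cos ((n : ℕ) * Real.sinh u) * rotatedExp (m : ℕ) α u) : ℝ) : ℂ) with hf
  have hev : ∀ᶠ α in 𝓝[<] (Real.pi / 2), α ∈ Set.Ioo 0 (Real.pi / 2) :=
    Ioo_mem_nhdsLT (by positivity)
  have ht : Tendsto (fun α => ∑' m, f α m) (𝓝[<] (Real.pi / 2))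
      (𝓝 (∑' m, a m * (((n : ℕ) * (Real.pi / 2 * if m = n then Real.pi / 2 else 0) : ℝ) : ℂ))) := by
    -- For `0 < α < π/2` the rotated exponential is at most `1` in modulus, which gives a summable
    -- bound independent of `α`.
    refine tendsto_tsum_of_dominated_convergence (bound := fun m => ‖a m‖ *
      ((n : ℕ) * (Real.pi / 2 * (Real.cosh (Real.arsinh Real.pi) * Real.arsinh Real.pi))))
      (ha.mul_right _) (fun m => ?_) ?_
    · exact ((Complex.continuous_ofReal.tendsto _).comp
        (((tendsto_abel_coefficient m n).const_mul _).const_mul _)).const_mul _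
    · filter_upwards [hev] with α hα m
      have h1 := abs_interval_integral_cosh_mul_le
        (f := fun u => Real.cos ((n : ℕ) * Real.sinh u) * rotatedExp (m : ℕ) α u) (fun u => by
          rw [abs_mul]
          refine mul_le_one₀ (Real.abs_cos_le_one _) (abs_nonneg _)
            ((abs_rotatedExp_le _ _ _).trans ?_)
          rw [Real.exp_le_one_iff]
          have h1 : 0 < Real.cos α :=
            cos_pos_of_abs_lt (by rw [abs_of_pos hα.1]; exact hα.2)
          have h2 := Real.cosh_pos u
          have h3 : 0 ≤ ((m : ℕ) : ℝ) * Real.cos α * Real.cosh u := by positivity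
          linarith)
      simp only [hf]
      rw [norm_mul, Complex.norm_real, Real.norm_eq_abs, abs_mul, abs_mul (Real.pi / 2),
        Nat.abs_cast, abs_of_pos (by positivity : 0 < Real.pi / 2)]
      simp only [mul_assoc] at h1 ⊢
      gcongr
  have hlim := ht.const_mul ((4 / (Real.pi ^ 2 * ((n : ℕ) : ℝ)) : ℝ) : ℂ)
  have hn : ((n : ℕ) : ℝ) ≠ 0 := by exact_mod_cast n.ne_zero
  have e : ((4 / (Real.pi ^ 2 * ((n : ℕ) : ℝ)) : ℝ) : ℂ) *
      ∑' m, a m * (((n : ℕ) * (Real.pi / 2 * if m = n then Real.pi / 2 else 0) : ℝ) : ℂ)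
      = a n := by
    rw [tsum_eq_single n (fun m hm => by simp [hm])]
    rw [if_pos rfl, mul_left_comm, ← Complex.ofReal_mul]
    have : 4 / (Real.pi ^ 2 * ((n : ℕ) : ℝ)) * ((n : ℕ) * (Real.pi / 2 * (Real.pi / 2))) = 1 := by
      have := Real.pi_pos.ne'
      field_simp
      norm_num
    rw [this]; simp
  rw [e] at hlim
  refine hlim.congr' ?_
  filter_upwards [hev] with α hα
  rw [← (abel_expansion ha n hα.1 hα.2).2.tsum_eq]

lemma continuous_improper_integrand {H : ℝ → ℂ} (hH : Continuous H) {x : ℝ} (hx : 0 < x)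
    (w : ℝ) :
    Continuous fun τ : ℝ => 2 * (((Real.cosh (Real.pi / 2 * τ) * klKernel x τ : ℝ) : ℂ) *
        ∫ u in (0 : ℝ)..w, H u * (Real.cos (u * τ) : ℂ)) := by
  have hk := continuous_klKernel hx
  have : Continuous fun τ : ℝ => ∫ u in (0 : ℝ)..w, H u * (Real.cos (u * τ) : ℂ) :=
    intervalIntegral.continuous_parametric_intervalIntegral_of_continuous'
      (by unfold Function.uncurry; fun_prop) _ _
  fun_prop

/-- The integrand is the transform pairing for `H u = cosh u ∑ m a_m cos(m sinh u)`. In the limit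
`H` is tested against `(π/2) cos(n sinh u)`, which selects `n a_n (π/2)²`. -/
lemma improper_expansion {a : ℕ+ → ℂ} (ha : Summable fun m : ℕ+ => ((m : ℕ) : ℝ) * ‖a m‖)
    (n : ℕ+) :
    (∀ N : ℝ, 0 < N → IntegrableOn (fun τ : ℝ =>
      ((τ * Real.sinh (Real.pi * τ) : ℝ) : ℂ) *
        macdonaldK (Complex.I * (τ : ℂ)) ((n : ℕ) : ℂ) *
        ∑' m : ℕ+,
          a m * incompleteKs ((m : ℕ) : ℝ) (Complex.I * (τ : ℂ)) (Real.arsinh Real.pi))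
      (Set.Ioc (0 : ℝ) N) volume) ∧
    Tendsto (fun N : ℝ =>
      ((2 / (Real.pi ^ 2 * ((n : ℕ) : ℝ)) : ℝ) : ℂ) *
        ∫ τ in (0 : ℝ)..N,
          ((τ * Real.sinh (Real.pi * τ) : ℝ) : ℂ) *
            macdonaldK (Complex.I * (τ : ℂ)) ((n : ℕ) : ℂ) *
            ∑' m : ℕ+,
              a m * incompleteKs ((m : ℕ) : ℝ) (Complex.I * (τ : ℂ)) (Real.arsinh Real.pi))
      atTop (𝓝 (a n)) := by
  have hc : Summable fun m : ℕ+ => ‖((m : ℕ) : ℂ) * a m‖ := by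
    simpa only [norm_mul, Complex.norm_natCast] using ha
  have hn : ((n : ℕ) : ℝ) ≠ 0 := by exact_mod_cast n.ne_zero
  have hn0 : 0 < ((n : ℕ) : ℝ) := by exact_mod_cast n.pos
  set H : ℝ → ℂ := fun u => (∑' m : ℕ+, ((m : ℕ) : ℂ) * a m *
    (Real.cos ((m : ℕ) * Real.sinh u) : ℂ)) * (Real.cosh u : ℂ) with hH_def
  have hH : Continuous H := (continuous_tsum_cos_sinh hc).mul (by fun_prop)
  have hcont := continuous_improper_integrand hH hn0 (Real.arsinh Real.pi)
  constructor
  -- The rewritten integrand is continuous on the whole line. It agrees with the original for `τ >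
  -- 0`, which is all that `(0, N]` requires.
  · intro N _
    refine IntegrableOn.congr_fun (hcont.integrableOn_Ioc) (fun τ hτ => ?_) measurableSet_Ioc
    exact (improper_integrand_eq hc n hτ.1).symm
  have hlim := ((tendsto_integral_cosh_mul_klKernel_mul hn0 hH arsinh_pi_pos.le).const_mul
    2).const_mul ((2 / (Real.pi ^ 2 * ((n : ℕ) : ℝ)) : ℝ) : ℂ)
  have e : ∫ u in (0 : ℝ)..Real.arsinh Real.pi,
      H u * ((Real.pi / 2 * Real.cos ((n : ℕ) * Real.sinh u) : ℝ) : ℂ)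
      = Real.pi / 2 * (((n : ℕ) : ℂ) * a n * (Real.pi / 2)) := by
    have h1 := (hasSum_integral_cos_sinh hc
      (g := fun u => Real.cosh u * Real.cos ((n : ℕ) * Real.sinh u))
      (by fun_prop) (Real.arsinh Real.pi)).tsum_eq
    simp only [fun m : ℕ+ => integral_cosh_mul_cos_sinh_mul_cos_sinh (n := n) m.pos,
      PNat.coe_inj] at h1
    rw [tsum_eq_single n (fun m hm => by simp [hm]), if_pos rfl] at h1
    push_cast at h1
    rw [h1, ← intervalIntegral.integral_const_mul]
    refine intervalIntegral.integral_congr fun u _ => ?_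
    simp only [hH_def]
    push_cast
    ring
  rw [e] at hlim
  have e2 : ((2 / (Real.pi ^ 2 * ((n : ℕ) : ℝ)) : ℝ) : ℂ) *
      (2 * (Real.pi / 2 * (((n : ℕ) : ℂ) * a n * (Real.pi / 2)))) = a n := by
    have h1 : (Real.pi : ℂ) ≠ 0 := by exact_mod_cast Real.pi_pos.ne'
    have h2 : ((n : ℕ) : ℂ) ≠ 0 := by exact_mod_cast hn
    push_cast
    field_simp
  rw [e2] at hlim
  refine hlim.congr' ?_
  filter_upwards [eventually_ge_atTop 0] with N hN
  congr 1
  rw [← intervalIntegral.integral_const_mul, intervalIntegral.integral_of_le hN,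
    intervalIntegral.integral_of_le hN]
  exact setIntegral_congr_fun measurableSet_Ioc fun τ hτ =>
    (improper_integrand_eq hc n hτ.1).symm

lemma summable_mul_macdonaldK {a : ℕ+ → ℂ} (ha : Summable fun m => ‖a m‖) (τ : ℝ) :
    Summable fun m : ℕ+ => a m * macdonaldK (Complex.I * (τ : ℂ)) ((m : ℕ) : ℂ) := by
  -- Any `β` in `[0, π/2)` would do; at `α = 0` the estimate bounds `K_{iτ}(m)` itself, uniformly in
  -- `m`.
  have hb := fun m : ℕ+ => abs_cosh_mul_klKernel_le_exp (one_le_pnat_cast m) (α := 0) (β := 1)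
    (by simp) (by linarith [Real.pi_gt_three]) τ
  refine Summable.of_norm_bounded (g := fun m => ‖a m‖ *
    (2 * (∫ v, Real.exp (-(Real.cos 1) * Real.cosh v)) * Real.exp (-(1 - |(0 : ℝ)|) * |τ|)))
    (ha.mul_right _) fun m => ?_
  have hK := macdonaldK_I_mul ((m : ℕ) : ℝ) τ
  rw [Complex.ofReal_natCast] at hK
  rw [norm_mul, hK, Complex.norm_real, Real.norm_eq_abs]
  refine mul_le_mul_of_nonneg_left ?_ (norm_nonneg _)
  simpa only [zero_mul, Real.cosh_zero, one_mul] using hb m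

lemma summable_mul_incompleteKs {a : ℕ+ → ℂ} (ha : Summable fun m => ‖a m‖) (τ : ℝ) :
    Summable fun m : ℕ+ =>
      a m * incompleteKs ((m : ℕ) : ℝ) (Complex.I * (τ : ℂ)) (Real.arsinh Real.pi) := by
  refine Summable.of_norm_bounded (g := fun m => ‖a m‖ *
    (|(Real.sinh (Real.pi * τ / 2))⁻¹| * Real.arsinh Real.pi)) (ha.mul_right _) fun m => ?_
  rw [norm_mul]
  exact mul_le_mul_of_nonneg_left (norm_incompleteKs_le _ τ arsinh_pi_pos.le) (norm_nonneg _)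

theorem theorem4 (a : ℕ+ → ℂ) (ha : Summable (fun m : ℕ+ => ‖a m‖)) :
    -- Abel-summed expansion
    ((∀ τ : ℝ, 0 < τ →
        Summable (fun m : ℕ+ => a m * macdonaldK (Complex.I * (τ : ℂ)) ((m : ℕ) : ℂ))) ∧
      ∀ n : ℕ+,
        (∀ α : ℝ, 0 < α → α < Real.pi / 2 →
          IntegrableOn (fun τ : ℝ =>
            ((τ * Real.sinh (Real.pi * τ / 2) * Real.cosh (α * τ) : ℝ) : ℂ) *
              incompleteKs ((n : ℕ) : ℝ) (Complex.I * (τ : ℂ)) (Real.arsinh Real.pi) *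
              ∑' m : ℕ+, a m * macdonaldK (Complex.I * (τ : ℂ)) ((m : ℕ) : ℂ))
            (Set.Ioi (0 : ℝ)) volume) ∧
        Tendsto (fun α : ℝ =>
          ((4 / (Real.pi ^ 2 * ((n : ℕ) : ℝ)) : ℝ) : ℂ) *
            ∫ τ in Set.Ioi (0 : ℝ),
              ((τ * Real.sinh (Real.pi * τ / 2) * Real.cosh (α * τ) : ℝ) : ℂ) *
                incompleteKs ((n : ℕ) : ℝ) (Complex.I * (τ : ℂ)) (Real.arsinh Real.pi) *
                ∑' m : ℕ+, a m * macdonaldK (Complex.I * (τ : ℂ)) ((m : ℕ) : ℂ))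
          (𝓝[<] (Real.pi / 2)) (𝓝 (a n))) ∧
    -- improper-integral expansion under the stronger condition
    (Summable (fun m : ℕ+ => ((m : ℕ) : ℝ) * ‖a m‖) →
      (∀ τ : ℝ, 0 < τ →
        Summable (fun m : ℕ+ =>
          a m * incompleteKs ((m : ℕ) : ℝ) (Complex.I * (τ : ℂ)) (Real.arsinh Real.pi))) ∧
      ∀ n : ℕ+,
        (∀ N : ℝ, 0 < N →
          IntegrableOn (fun τ : ℝ =>
            ((τ * Real.sinh (Real.pi * τ) : ℝ) : ℂ) *
              macdonaldK (Complex.I * (τ : ℂ)) ((n : ℕ) : ℂ) *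
              ∑' m : ℕ+,
                a m * incompleteKs ((m : ℕ) : ℝ) (Complex.I * (τ : ℂ)) (Real.arsinh Real.pi))
            (Set.Ioc (0 : ℝ) N) volume) ∧
        Tendsto (fun N : ℝ =>
          ((2 / (Real.pi ^ 2 * ((n : ℕ) : ℝ)) : ℝ) : ℂ) *
            ∫ τ in (0 : ℝ)..N,
              ((τ * Real.sinh (Real.pi * τ) : ℝ) : ℂ) *
                macdonaldK (Complex.I * (τ : ℂ)) ((n : ℕ) : ℂ) *
                ∑' m : ℕ+,
                  a m * incompleteKs ((m : ℕ) : ℝ) (Complex.I * (τ : ℂ)) (Real.arsinh Real.pi))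
          atTop (𝓝 (a n))) := by
  refine ⟨⟨fun τ _ => summable_mul_macdonaldK ha τ, fun n =>
    ⟨fun α hα0 hα => (abel_expansion ha n hα0 hα).1, tendsto_abel_expansion ha n⟩⟩, fun ha' =>
    ⟨fun τ _ => summable_mul_incompleteKs ha τ, fun n => improper_expansion ha' n⟩⟩
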